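/- Let $E\to\mathbb R^n$ be a (real or complex) vector bundle of finite rank with a fibre metric, and let $0<T\le\infty$. For a smooth metric connection $\nabla$ on $E$, with connection coefficient matrices $\Gamma_i$ in a global orthonormal frame (so $\Gamma_i$ is skew-Hermitian), curvature $F_{ij}=\partial_i\Gamma_j-\partial_j\Gamma_i+[\Gamma_i,\Gamma_j]$ and $|F_\nabla|^2=\sum_{i,j}|F_{ij}|^2=-\sum_{i,j}\operatorname{tr}(F_{ij}F_{ij})$, set, for $x_0\in\mathbb R^n$ and $t_0>0$, $$\mathcal F_{x_0,t_0}(\nabla)=t_0^2\,(4\pi t_0)^{-n/2}\int_{\mathbb R^n}|F_\nabla|^2\,e^{-\frac{|x-x_0|^2}{4t_0}}\,dx\in[0,\infty],\qquad \lambda(\nabla)=\sup_{x_0\in\mathbb R^n,\ t_0>0}\mathcal F_{x_0,t_0}(\nabla)\in[0,\infty].$$ Let $(\nabla_t)_{t\in[0,T)}$ be a family of metric connections on $E$, smooth on $\mathbb R^n\times[0,T)$, that solves the Yang–Mills flow $\partial_t\nabla_t=-D^*_{\nabla_t}F_{\nabla_t}$, that is, $\partial_t\Gamma_j=\sum_i\nabla_iF_{ij}$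 with $\nabla_iF_{ij}=\partial_iF_{ij}+[\Gamma_i,F_{ij}]$. Suppose that it has polynomial energy growth, locally uniformly in time: for every $\tau\in[0,T)$ there are a point $y\in\mathbb R^n$ and a real polynomial $p$ such that $$\int_{B_y(r)}|F_{\nabla_t}|^2\,dx\le p(r)\qquad\text{for all } r>0 \text{ and all } t\in[0,\tau].$$ Then $\lambda(\nabla_t)$ is non-increasing in $t$ on $[0,T)$: if $0\le t_1\le t_2<T$, then $\lambda(\nabla_{t_2})\le\lambda(\nabla_{t_1})$. -/

import Mathlib

open scoped ContDiff Matrix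

namespace YangMills

/-- A smooth metric connection on a smooth vector bundle of rank `k` (real or complex, with a
fibre metric) over `ℝⁿ`. Such a bundle has a global orthonormal frame `μ`, in which the connection
is given by its coefficient matrices `∇_i μ_α = ∑ β, (coeff x i) β α • μ_β`; compatibility with the
fibre metric says that these are skew-Hermitian (skew-symmetric if `𝕜 = ℝ`). -/
structure MetricConnection (𝕜 : Type*) [RCLike 𝕜] (n k : ℕ) where
  coeff : EuclideanSpace ℝ (Fin n) → Fin n → Matrix (Fin k) (Fin k) 𝕜
  smooth : ∀ i β α, ContDiff ℝ ∞ fun x => coeff x i β α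
  skew : ∀ x i, (coeff x i)ᴴ = -coeff x i

/-- The entrywise partial derivative `∂_i M` of a matrix-valued function on `ℝⁿ`. -/
noncomputable def partialDeriv {𝕜 : Type*} [RCLike 𝕜] {n k : ℕ} (i : Fin n)
    (M : EuclideanSpace ℝ (Fin n) → Matrix (Fin k) (Fin k) 𝕜)
    (x : EuclideanSpace ℝ (Fin n)) : Matrix (Fin k) (Fin k) 𝕜 :=
  Matrix.of fun β α => fderiv ℝ (fun y => M y β α) x (EuclideanSpace.single i 1)

namespace MetricConnection

variable {𝕜 : Type*} [RCLike 𝕜] {n k : ℕ}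

/-- The curvature `F_ij = ∂_i Γ_j - ∂_j Γ_i + Γ_i Γ_j - Γ_j Γ_i`. -/
noncomputable def curvature (A : MetricConnection 𝕜 n k) (i j : Fin n)
    (x : EuclideanSpace ℝ (Fin n)) : Matrix (Fin k) (Fin k) 𝕜 :=
  partialDeriv i (fun y => A.coeff y j) x - partialDeriv j (fun y => A.coeff y i) x
    + A.coeff x i * A.coeff x j - A.coeff x j * A.coeff x i

/-- The covariant derivative `∇_l M = ∂_l M + [Γ_l, M]` of a section `M` of `End E`. -/
noncomputable def covDeriv (A : MetricConnection 𝕜 n k) (l : Fin n)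
    (M : EuclideanSpace ℝ (Fin n) → Matrix (Fin k) (Fin k) 𝕜)
    (x : EuclideanSpace ℝ (Fin n)) : Matrix (Fin k) (Fin k) 𝕜 :=
  partialDeriv l M x + A.coeff x l * M x - M x * A.coeff x l

/-- The `End E`-valued one-form `D^* F`, with components `(D^* F)_j = -∑ i, ∇_i F_ij`. -/
noncomputable def dStarCurvature (A : MetricConnection 𝕜 n k) (j : Fin n)
    (x : EuclideanSpace ℝ (Fin n)) : Matrix (Fin k) (Fin k) 𝕜 :=
  -∑ i, A.covDeriv i (A.curvature i j) x

/-- The pointwise norm `|F|² = ∑ i j, |F_ij|²`, with the Hilbert-Schmidt norm on matrices; as the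
`F_ij` are skew-Hermitian, this is `-∑ i j, tr (F_ij F_ij)`. -/
noncomputable def curvatureNormSq (A : MetricConnection 𝕜 n k)
    (x : EuclideanSpace ℝ (Fin n)) : ℝ :=
  ∑ i, ∑ j, ∑ β, ∑ α, ‖A.curvature i j x β α‖ ^ 2

/-- The functional `F_{x₀,t₀}`, with values in `[0, ∞]`. -/
noncomputable def shrinkerFunctional (A : MetricConnection 𝕜 n k)
    (x₀ : EuclideanSpace ℝ (Fin n)) (t₀ : ℝ) : ENNReal :=
  ENNReal.ofReal (t₀ ^ 2 * (4 * Real.pi * t₀) ^ (-(n : ℝ) / 2)) *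
    ∫⁻ x, ENNReal.ofReal (A.curvatureNormSq x * Real.exp (-‖x - x₀‖ ^ 2 / (4 * t₀)))

/-- The entropy: the supremum of `F_{x₀,t₀}` over `x₀ ∈ ℝⁿ` and `t₀ > 0`, in `[0, ∞]`. -/
noncomputable def entropy (A : MetricConnection 𝕜 n k) : ENNReal :=
  ⨆ (x₀ : EuclideanSpace ℝ (Fin n)) (t₀ : ℝ) (_ : 0 < t₀), A.shrinkerFunctional x₀ t₀

/-- The energy of `A` in the ball of radius `r` about `y` is at most `p r`, for every `r > 0`. -/
def HasEnergyGrowth (A : MetricConnection 𝕜 n k) (y : EuclideanSpace ℝ (Fin n))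
    (p : Polynomial ℝ) : Prop :=
  ∀ r : ℝ, 0 < r →
    ∫⁻ x in Metric.ball y r, ENNReal.ofReal (A.curvatureNormSq x) ≤ ENNReal.ofReal (p.eval r)

end MetricConnection

/-- The time interval `[0, T)`, where `T = ∞` is allowed. -/
def timeInterval (T : EReal) : Set ℝ := {t | 0 ≤ t ∧ (t : EReal) < T}

/-- A family of connections that is smooth on `ℝⁿ × [0, T)` and solves the Yang-Mills flow
`∂Γ/∂t = -D^* F` there (with a one-sided time derivative at `t = 0`). -/
structure IsYangMillsFlow {𝕜 : Type*} [RCLike 𝕜] {n k : ℕ} (T : EReal)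
    (A : ℝ → MetricConnection 𝕜 n k) : Prop where
  smooth : ∀ i β α, ContDiffOn ℝ ∞
    (fun q : ℝ × EuclideanSpace ℝ (Fin n) => (A q.1).coeff q.2 i β α)
    (timeInterval T ×ˢ Set.univ)
  evolution : ∀ t ∈ timeInterval T, ∀ x j β α,
    HasDerivWithinAt (fun s => (A s).coeff x j β α) (-((A t).dStarCurvature j x β α))
      (timeInterval T) t

/-- Polynomial energy growth of a family on `[0, T)`: on each compact time interval `[0, τ]` in
`[0, T)`, the connections have polynomial energy growth about some point, with the same point and
polynomial for all times in `[0, τ]`. -/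
def HasPolynomialEnergyGrowth {𝕜 : Type*} [RCLike 𝕜] {n k : ℕ} (T : EReal)
    (A : ℝ → MetricConnection 𝕜 n k) : Prop :=
  ∀ τ ∈ timeInterval T, ∃ (y : EuclideanSpace ℝ (Fin n)) (p : Polynomial ℝ),
    ∀ t ∈ Set.Icc 0 τ, (A t).HasEnergyGrowth y p

end YangMills

/-! This is the Yang–Mills counterpart of Huisken's monotonicity formula. Fix x₀ and a time a > t₂,
put τ = a − t, and let w be τ² times the backward heat kernel centred at (x₀, a). Then Φ(t) = ∫ w
|F|² is the functional at time t with scale τ. Write X = (x − x₀)/(2τ), E_j = ∑ ∇_i F_ij for the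
velocity of the flow, and V_j = ∑ X_l F_lj. Formally Φ' = −4 ∫ w |E − V|² ≤ 0.

The reason is pointwise. The density |F|² changes at rate 4 ∑ ⟨F_ij, ∇_i E_j⟩, the weight at rate
((n/2 − 2)/τ − |X|²) w, and ∇w = −X w. The Bianchi identity turns ∑ ⟨∇_i F_lj, F_ij⟩ into half of ∑
⟨∇_l F_ij, F_ij⟩, so the total rate is the divergence of an explicit vector field minus 4 w |E − V|²
(`divergence_identity`).

No decay of derivatives of F is known, so w is multiplied by ψ² for a cutoff ψ at radius R. The
cross term between ∇ψ and E − V is absorbed by the good square (`divergence_error_le`), leaving an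
error that involves only |F|² on the annulus between radii R and 2R. There the Gaussian is at most a
constant times exp(−R²/(4(a − t₁))), while the energy grows polynomially, uniformly in time; the
error vanishes as R → ∞ (`integral_cutoff_error_le`). Integrating in time
(`localized_functional_le`) and removing the cutoff give Φ(t₂) ≤ Φ(t₁).

With a = t₀ + t₂ this bounds the functional of ∇_{t₂} at scale t₀ by that of ∇_{t₁} at scale t₀ + t₂
− t₁ (`shrinkerFunctional_le`), hence by the entropy at t₁. Take the supremum. -/

namespace YangMills

/-! ### Hilbert–Schmidt product and entrywise calculus of matrix-valued functions. -/

section MatrixCalculus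

variable {𝕜 : Type*} [RCLike 𝕜] {n k : ℕ}

/-- The real Hilbert-Schmidt inner product of two matrices. -/
noncomputable def hs (M N : Matrix (Fin k) (Fin k) 𝕜) : ℝ :=
  ∑ β, ∑ α, inner ℝ (M β α) (N β α)

theorem hs_comm (M N : Matrix (Fin k) (Fin k) 𝕜) : hs M N = hs N M := by
  simp only [hs, real_inner_comm]

theorem hs_add_left (M M' N : Matrix (Fin k) (Fin k) 𝕜) : hs (M + M') N = hs M N + hs M' N := by
  simp only [hs, Matrix.add_apply, inner_add_left, Finset.sum_add_distrib]

theorem hs_smul_left (c : ℝ) (M N : Matrix (Fin k) (Fin k) 𝕜) : hs (c • M) N = c * hs M N := by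
  simp only [hs, Matrix.smul_apply, real_inner_smul_left, Finset.mul_sum]

theorem hs_neg_left (M N : Matrix (Fin k) (Fin k) 𝕜) : hs (-M) N = -hs M N := by
  simp only [hs, Matrix.neg_apply, inner_neg_left, Finset.sum_neg_distrib]

theorem hs_sub_left (M M' N : Matrix (Fin k) (Fin k) 𝕜) : hs (M - M') N = hs M N - hs M' N := by
  rw [sub_eq_add_neg, hs_add_left, hs_neg_left, sub_eq_add_neg]

theorem hs_add_right (M N N' : Matrix (Fin k) (Fin k) 𝕜) : hs M (N + N') = hs M N + hs M N' := by
  rw [hs_comm, hs_add_left, hs_comm N, hs_comm N']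

theorem hs_smul_right (c : ℝ) (M N : Matrix (Fin k) (Fin k) 𝕜) : hs M (c • N) = c * hs M N := by
  rw [hs_comm, hs_smul_left, hs_comm]

theorem hs_neg_right (M N : Matrix (Fin k) (Fin k) 𝕜) : hs M (-N) = -hs M N := by
  rw [hs_comm, hs_neg_left, hs_comm]

theorem hs_sub_right (M N N' : Matrix (Fin k) (Fin k) 𝕜) : hs M (N - N') = hs M N - hs M N' := by
  rw [hs_comm, hs_sub_left, hs_comm N, hs_comm N']

theorem hs_zero_left (N : Matrix (Fin k) (Fin k) 𝕜) : hs 0 N = 0 := by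
  simp [hs]

theorem hs_sum_left {ι : Type*} (s : Finset ι) (M : ι → Matrix (Fin k) (Fin k) 𝕜)
    (N : Matrix (Fin k) (Fin k) 𝕜) : hs (∑ i ∈ s, M i) N = ∑ i ∈ s, hs (M i) N := by
  induction s using Finset.cons_induction with
  | empty => simp [hs_zero_left]
  | cons a s ha ih => rw [Finset.sum_cons, Finset.sum_cons, hs_add_left, ih]

theorem hs_sum_right {ι : Type*} (s : Finset ι) (N : ι → Matrix (Fin k) (Fin k) 𝕜)
    (M : Matrix (Fin k) (Fin k) 𝕜) : hs M (∑ i ∈ s, N i) = ∑ i ∈ s, hs M (N i) := by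
  rw [hs_comm, hs_sum_left]
  simp only [hs_comm M]

theorem hs_self (M : Matrix (Fin k) (Fin k) 𝕜) : hs M M = ∑ β, ∑ α, ‖M β α‖ ^ 2 := by
  simp only [hs, real_inner_self_eq_norm_sq]

theorem hs_self_nonneg (M : Matrix (Fin k) (Fin k) 𝕜) : 0 ≤ hs M M := by
  rw [hs_self]
  positivity

/-- The trace form makes cyclicity available for `hs_commutator_add`. -/
theorem hs_eq_re_trace (M N : Matrix (Fin k) (Fin k) 𝕜) :
    hs M N = RCLike.re (Matrix.trace (Mᴴ * N)) := by
  simp only [hs, Matrix.trace, Matrix.diag, Matrix.mul_apply, Matrix.conjTranspose_apply, map_sum]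
  rw [Finset.sum_comm]
  refine Finset.sum_congr rfl fun α _ => Finset.sum_congr rfl fun β _ => ?_
  simp [real_inner_eq_re_inner 𝕜, mul_comm]

/-- The adjoint action of a skew-Hermitian matrix is skew for the Hilbert-Schmidt product. -/
theorem hs_commutator_add (G M N : Matrix (Fin k) (Fin k) 𝕜) (hG : Gᴴ = -G) :
    hs (G * M - M * G) N + hs M (G * N - N * G) = 0 := by
  have h : Matrix.trace ((G * M - M * G)ᴴ * N) + Matrix.trace (Mᴴ * (G * N - N * G)) = 0 := by
    rw [Matrix.conjTranspose_sub, Matrix.conjTranspose_mul, Matrix.conjTranspose_mul, hG,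
      ← Matrix.trace_add]
    have : (Mᴴ * -G - -G * Mᴴ) * N + Mᴴ * (G * N - N * G) = G * (Mᴴ * N) - (Mᴴ * N) * G := by
      noncomm_ring
    rw [this, Matrix.trace_sub, Matrix.trace_mul_comm, sub_self]
  rw [hs_eq_re_trace, hs_eq_re_trace, ← map_add, h, map_zero]

/-- The Cauchy-Schwarz inequality for a linear combination of matrices. -/
theorem hs_sum_smul_self_le {ι : Type*} (s : Finset ι) (a : ι → ℝ)
    (M : ι → Matrix (Fin k) (Fin k) 𝕜) :
    hs (∑ i ∈ s, a i • M i) (∑ i ∈ s, a i • M i) ≤ (∑ i ∈ s, a i ^ 2) * ∑ i ∈ s, hs (M i) (M i) := by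
  have key : ∀ β α, ‖(∑ i ∈ s, a i • M i) β α‖ ^ 2
      ≤ (∑ i ∈ s, a i ^ 2) * ∑ i ∈ s, ‖M i β α‖ ^ 2 := by
    intro β α
    have h1 : ‖(∑ i ∈ s, a i • M i) β α‖ ≤ ∑ i ∈ s, |a i| * ‖M i β α‖ := by
      rw [Matrix.sum_apply]
      refine (norm_sum_le _ _).trans (Finset.sum_le_sum fun i _ => ?_)
      rw [Matrix.smul_apply, norm_smul, Real.norm_eq_abs]
    have h2 := Finset.sum_mul_sq_le_sq_mul_sq s (fun i => |a i|) (fun i => ‖M i β α‖)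
    simp only [sq_abs] at h2
    exact (pow_le_pow_left₀ (norm_nonneg _) h1 2).trans h2
  simp only [hs_self]
  calc _ ≤ ∑ β, ∑ α, (∑ i ∈ s, a i ^ 2) * ∑ i ∈ s, ‖M i β α‖ ^ 2 :=
        Finset.sum_le_sum fun β _ => Finset.sum_le_sum fun α _ => key β α
    _ = _ := by
        simp only [← Finset.mul_sum]
        congr 1
        symm
        rw [Finset.sum_comm]
        exact Finset.sum_congr rfl fun β _ => Finset.sum_comm

/-- Entrywise differentiability of a curve of matrices. -/
def MatHasDerivAt (P : ℝ → Matrix (Fin k) (Fin k) 𝕜) (P' : Matrix (Fin k) (Fin k) 𝕜) (s : ℝ) :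
    Prop :=
  ∀ β α, HasDerivAt (fun s => P s β α) (P' β α) s

theorem MatHasDerivAt.add {P Q : ℝ → Matrix (Fin k) (Fin k) 𝕜} {P' Q' : Matrix (Fin k) (Fin k) 𝕜}
    {s : ℝ} (hP : MatHasDerivAt P P' s) (hQ : MatHasDerivAt Q Q' s) :
    MatHasDerivAt (fun s => P s + Q s) (P' + Q') s :=
  fun β α => (hP β α).add (hQ β α)

theorem MatHasDerivAt.sub {P Q : ℝ → Matrix (Fin k) (Fin k) 𝕜} {P' Q' : Matrix (Fin k) (Fin k) 𝕜}
    {s : ℝ} (hP : MatHasDerivAt P P' s) (hQ : MatHasDerivAt Q Q' s) :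
    MatHasDerivAt (fun s => P s - Q s) (P' - Q') s :=
  fun β α => (hP β α).sub (hQ β α)

theorem MatHasDerivAt.mul {P Q : ℝ → Matrix (Fin k) (Fin k) 𝕜} {P' Q' : Matrix (Fin k) (Fin k) 𝕜}
    {s : ℝ} (hP : MatHasDerivAt P P' s) (hQ : MatHasDerivAt Q Q' s) :
    MatHasDerivAt (fun s => P s * Q s) (P' * Q s + P s * Q') s := by
  intro β α
  simp only [Matrix.add_apply, Matrix.mul_apply, ← Finset.sum_add_distrib]
  exact HasDerivAt.fun_sum fun γ _ => (hP β γ).mul (hQ γ α)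

theorem MatHasDerivAt.hs {P Q : ℝ → Matrix (Fin k) (Fin k) 𝕜} {P' Q' : Matrix (Fin k) (Fin k) 𝕜}
    {s : ℝ} (hP : MatHasDerivAt P P' s) (hQ : MatHasDerivAt Q Q' s) :
    HasDerivAt (fun s => hs (P s) (Q s)) (hs P' (Q s) + hs (P s) Q') s := by
  simp only [YangMills.hs, ← Finset.sum_add_distrib]
  refine HasDerivAt.fun_sum fun β _ => HasDerivAt.fun_sum fun α _ => ?_
  rw [add_comm]
  exact (hP β α).inner ℝ (hQ β α)

/-- Entrywise smoothness of a matrix-valued function. -/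
def MatSmooth (M : EuclideanSpace ℝ (Fin n) → Matrix (Fin k) (Fin k) 𝕜) : Prop :=
  ∀ β α, ContDiff ℝ ∞ fun x => M x β α

namespace MatSmooth

variable {M N : EuclideanSpace ℝ (Fin n) → Matrix (Fin k) (Fin k) 𝕜}

theorem add (hM : MatSmooth M) (hN : MatSmooth N) : MatSmooth fun x => M x + N x :=
  fun β α => (hM β α).add (hN β α)

theorem sub (hM : MatSmooth M) (hN : MatSmooth N) : MatSmooth fun x => M x - N x :=
  fun β α => (hM β α).sub (hN β α)

theorem mul (hM : MatSmooth M) (hN : MatSmooth N) : MatSmooth fun x => M x * N x := by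
  intro β α
  simp only [Matrix.mul_apply]
  exact ContDiff.sum fun γ _ => (hM β γ).mul (hN γ α)

theorem sum {ι : Type*} {s : Finset ι}
    {M : ι → EuclideanSpace ℝ (Fin n) → Matrix (Fin k) (Fin k) 𝕜} (hM : ∀ i ∈ s, MatSmooth (M i)) :
    MatSmooth fun x => ∑ i ∈ s, M i x := by
  intro β α
  simp only [Matrix.sum_apply]
  exact ContDiff.sum fun i hi => hM i hi β α

theorem hs (hM : MatSmooth M) (hN : MatSmooth N) : ContDiff ℝ ∞ fun x => hs (M x) (N x) := by
  simp only [YangMills.hs]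
  exact ContDiff.sum fun β _ => ContDiff.sum fun α _ => (hM β α).inner ℝ (hN β α)

theorem partialDeriv (hM : MatSmooth M) (i : Fin n) : MatSmooth (partialDeriv i M) := by
  intro β α
  simp only [YangMills.partialDeriv, Matrix.of_apply]
  exact ((hM β α).fderiv_right (m := ∞) (by simp)).clm_apply contDiff_const

/-- The partial derivative is the derivative along a coordinate line. -/
theorem hasDerivAt (hM : MatSmooth M) (i : Fin n) (x : EuclideanSpace ℝ (Fin n)) :
    MatHasDerivAt (fun s => M (x + s • EuclideanSpace.single i (1 : ℝ)))
      (YangMills.partialDeriv i M x) 0 := by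
  intro β α
  simp only [YangMills.partialDeriv, Matrix.of_apply]
  exact (((hM β α).differentiable (by simp)) x).hasFDerivAt.hasLineDerivAt _

end MatSmooth

/-- Transfers the sum and product rules for curves to `partialDeriv`, by comparing derivatives along
coordinate lines. -/
theorem MatHasDerivAt.unique {P : ℝ → Matrix (Fin k) (Fin k) 𝕜} {P' Q' : Matrix (Fin k) (Fin k) 𝕜}
    {s : ℝ} (hP : MatHasDerivAt P P' s) (hQ : MatHasDerivAt P Q' s) : P' = Q' := by
  ext β α
  exact (hP β α).unique (hQ β α)

theorem partialDeriv_add {M N : EuclideanSpace ℝ (Fin n) → Matrix (Fin k) (Fin k) 𝕜}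
    (hM : MatSmooth M) (hN : MatSmooth N) (i : Fin n) (x : EuclideanSpace ℝ (Fin n)) :
    partialDeriv i (fun x => M x + N x) x = partialDeriv i M x + partialDeriv i N x :=
  ((hM.add hN).hasDerivAt i x).unique ((hM.hasDerivAt i x).add (hN.hasDerivAt i x))

theorem partialDeriv_sub {M N : EuclideanSpace ℝ (Fin n) → Matrix (Fin k) (Fin k) 𝕜}
    (hM : MatSmooth M) (hN : MatSmooth N) (i : Fin n) (x : EuclideanSpace ℝ (Fin n)) :
    partialDeriv i (fun x => M x - N x) x = partialDeriv i M x - partialDeriv i N x :=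
  ((hM.sub hN).hasDerivAt i x).unique ((hM.hasDerivAt i x).sub (hN.hasDerivAt i x))

theorem partialDeriv_mul {M N : EuclideanSpace ℝ (Fin n) → Matrix (Fin k) (Fin k) 𝕜}
    (hM : MatSmooth M) (hN : MatSmooth N) (i : Fin n) (x : EuclideanSpace ℝ (Fin n)) :
    partialDeriv i (fun x => M x * N x) x = partialDeriv i M x * N x + M x * partialDeriv i N x := by
  have h := ((hM.hasDerivAt i x).mul (hN.hasDerivAt i x))
  simp only [zero_smul, add_zero] at h
  exact ((hM.mul hN).hasDerivAt i x).unique h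

theorem partialDeriv_comm {M : EuclideanSpace ℝ (Fin n) → Matrix (Fin k) (Fin k) 𝕜}
    (hM : MatSmooth M) (i j : Fin n) (x : EuclideanSpace ℝ (Fin n)) :
    partialDeriv i (partialDeriv j M) x = partialDeriv j (partialDeriv i M) x := by
  ext β α
  have hd : DifferentiableAt ℝ (fderiv ℝ fun y => M y β α) x :=
    (((hM β α).fderiv_right (m := 1) (by norm_cast)).differentiable (by simp)) x
  have hs : IsSymmSndFDerivAt ℝ (fun y => M y β α) x :=
    (contDiff_infty.1 (hM β α) 2).contDiffAt.isSymmSndFDerivAt (by simp)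
  simp only [partialDeriv, Matrix.of_apply]
  rw [fderiv_clm_apply hd (by fun_prop), fderiv_clm_apply hd (by fun_prop)]
  simpa using hs _ _

end MatrixCalculus

/-! ### Covariant calculus: Bianchi identity and metric compatibility. -/

namespace MetricConnection

variable {𝕜 : Type*} [RCLike 𝕜] {n k : ℕ} (A : MetricConnection 𝕜 n k)

theorem matSmooth_coeff (i : Fin n) : MatSmooth fun x => A.coeff x i :=
  A.smooth i

theorem matSmooth_curvature (i j : Fin n) : MatSmooth (A.curvature i j) :=
  ((((A.matSmooth_coeff j).partialDeriv i).sub ((A.matSmooth_coeff i).partialDeriv j)).add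
    ((A.matSmooth_coeff i).mul (A.matSmooth_coeff j))).sub
    ((A.matSmooth_coeff j).mul (A.matSmooth_coeff i))

theorem matSmooth_covDeriv {M : EuclideanSpace ℝ (Fin n) → Matrix (Fin k) (Fin k) 𝕜}
    (hM : MatSmooth M) (l : Fin n) : MatSmooth (A.covDeriv l M) :=
  ((hM.partialDeriv l).add ((A.matSmooth_coeff l).mul hM)).sub (hM.mul (A.matSmooth_coeff l))

/-- The components `∑ i, ∇_i F_ij` of the velocity of the Yang-Mills flow. -/
noncomputable def divCurvature (j : Fin n) (x : EuclideanSpace ℝ (Fin n)) :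
    Matrix (Fin k) (Fin k) 𝕜 :=
  ∑ i, A.covDeriv i (A.curvature i j) x

theorem matSmooth_divCurvature (j : Fin n) : MatSmooth (A.divCurvature j) :=
  MatSmooth.sum fun i _ => A.matSmooth_covDeriv (A.matSmooth_curvature i j) i

theorem curvature_antisymm (i j : Fin n) (x : EuclideanSpace ℝ (Fin n)) :
    A.curvature j i x = -A.curvature i j x := by
  simp only [curvature]
  abel

theorem covDeriv_curvature_antisymm (l i j : Fin n) (x : EuclideanSpace ℝ (Fin n)) :
    A.covDeriv l (A.curvature j i) x = -A.covDeriv l (A.curvature i j) x := by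
  have h : A.curvature j i = fun x => -A.curvature i j x := funext fun x => A.curvature_antisymm i j x
  have h2 : partialDeriv l (A.curvature j i) x = -partialDeriv l (A.curvature i j) x := by
    ext β α
    simp only [partialDeriv, Matrix.of_apply, h, Matrix.neg_apply]
    rw [fderiv_fun_neg]
    rfl
  simp only [covDeriv, h2, A.curvature_antisymm i j]
  noncomm_ring

/-- After expansion the second derivatives of Γ cancel in pairs by symmetry, the products of Γ with
∂Γ cancel against the commutators, and the cubic terms cancel by the Jacobi identity. -/
theorem bianchi (i j l : Fin n) (x : EuclideanSpace ℝ (Fin n)) :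
    A.covDeriv i (A.curvature j l) x + A.covDeriv j (A.curvature l i) x
      + A.covDeriv l (A.curvature i j) x = 0 := by
  have key : ∀ i j l : Fin n, partialDeriv i (A.curvature j l) x =
      partialDeriv i (partialDeriv j fun y => A.coeff y l) x
      - partialDeriv i (partialDeriv l fun y => A.coeff y j) x
      + (partialDeriv i (fun y => A.coeff y j) x * A.coeff x l
        + A.coeff x j * partialDeriv i (fun y => A.coeff y l) x)
      - (partialDeriv i (fun y => A.coeff y l) x * A.coeff x j
        + A.coeff x l * partialDeriv i (fun y => A.coeff y j) x) := by
    intro i j l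
    have hc := A.matSmooth_coeff
    have h1 : MatSmooth fun x => partialDeriv j (fun y => A.coeff y l) x :=
      (hc l).partialDeriv j
    have h2 : MatSmooth fun x => partialDeriv l (fun y => A.coeff y j) x :=
      (hc j).partialDeriv l
    unfold curvature
    rw [partialDeriv_sub ((h1.sub h2).add ((hc j).mul (hc l))) ((hc l).mul (hc j)),
      partialDeriv_add (h1.sub h2) ((hc j).mul (hc l)), partialDeriv_sub h1 h2,
      partialDeriv_mul (hc j) (hc l), partialDeriv_mul (hc l) (hc j)]
  simp only [covDeriv, key]
  rw [partialDeriv_comm (A.matSmooth_coeff l) i j, partialDeriv_comm (A.matSmooth_coeff j) i l,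
    partialDeriv_comm (A.matSmooth_coeff i) j l]
  simp only [curvature]
  noncomm_ring

theorem curvatureNormSq_eq (x : EuclideanSpace ℝ (Fin n)) :
    A.curvatureNormSq x = ∑ i, ∑ j, hs (A.curvature i j x) (A.curvature i j x) := by
  simp only [curvatureNormSq, hs_self]

theorem curvatureNormSq_nonneg (x : EuclideanSpace ℝ (Fin n)) : 0 ≤ A.curvatureNormSq x := by
  unfold curvatureNormSq
  positivity

theorem contDiff_curvatureNormSq : ContDiff ℝ ∞ A.curvatureNormSq := by
  have : A.curvatureNormSq = fun x => ∑ i, ∑ j, hs (A.curvature i j x) (A.curvature i j x) :=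
    funext A.curvatureNormSq_eq
  rw [this]
  exact ContDiff.sum fun i _ => ContDiff.sum fun j _ =>
    (A.matSmooth_curvature i j).hs (A.matSmooth_curvature i j)

/-- The Hilbert-Schmidt product is parallel for a metric connection. -/
theorem hasDerivAt_hs {M N : EuclideanSpace ℝ (Fin n) → Matrix (Fin k) (Fin k) 𝕜}
    (hM : MatSmooth M) (hN : MatSmooth N) (i : Fin n) (x : EuclideanSpace ℝ (Fin n)) :
    HasDerivAt (fun s : ℝ => hs (M (x + s • EuclideanSpace.single i (1 : ℝ)))
        (N (x + s • EuclideanSpace.single i (1 : ℝ))))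
      (hs (A.covDeriv i M x) (N x) + hs (M x) (A.covDeriv i N x)) 0 := by
  have h := (hM.hasDerivAt i x).hs (hN.hasDerivAt i x)
  simp only [zero_smul, add_zero] at h
  -- The two commutator terms add up to zero, so ∂_i may be replaced by ∇_i in both slots.
  have hc := hs_commutator_add (A.coeff x i) (M x) (N x) (A.skew x i)
  convert h using 1
  simp only [covDeriv, hs_add_left, hs_add_right, hs_sub_left, hs_sub_right] at hc ⊢
  linarith

end MetricConnection

end YangMills

/-! ### Pointwise algebra of the monotonicity formula. -/

namespace YangMills

variable {𝕜 : Type*} [RCLike 𝕜] {n k : ℕ}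

/-- The contraction of the Bianchi identity with the curvature. -/
theorem two_mul_sum_hs_of_bianchi (F : Fin n → Fin n → Matrix (Fin k) (Fin k) 𝕜)
    (DF : Fin n → Fin n → Fin n → Matrix (Fin k) (Fin k) 𝕜)
    (hF : ∀ i j, F j i = -F i j) (hDF : ∀ l i j, DF l j i = -DF l i j)
    (hB : ∀ i j l, DF i j l + DF j l i + DF l i j = 0) (l : Fin n) :
    2 * ∑ i, ∑ j, hs (DF i l j) (F i j) = ∑ i, ∑ j, hs (DF l i j) (F i j) := by
  -- Exchanging the indices and using antisymmetry twice gives a second form of the sum; Bianchi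
  -- adds the two forms up to the right-hand side.
  have h1 : ∑ i, ∑ j, hs (DF i l j) (F i j) = ∑ i, ∑ j, hs (DF j i l) (F i j) := by
    rw [Finset.sum_comm]
    refine Finset.sum_congr rfl fun i _ => Finset.sum_congr rfl fun j _ => ?_
    rw [hF i j, hDF j i l, hs_neg_left, hs_neg_right, neg_neg]
  rw [two_mul]
  nth_rewrite 2 [h1]
  simp only [← Finset.sum_add_distrib]
  refine Finset.sum_congr rfl fun i _ => Finset.sum_congr rfl fun j _ => ?_
  rw [← hs_add_left]
  congr 1
  have h2 := hB i j l
  rw [hDF i l j, hDF j i l] at h2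
  rw [← sub_eq_zero, ← neg_eq_zero, ← h2]
  abel

/-- The pointwise divergence identity behind the monotonicity formula. -/
theorem divergence_identity (F : Fin n → Fin n → Matrix (Fin k) (Fin k) 𝕜)
    (DF : Fin n → Fin n → Fin n → Matrix (Fin k) (Fin k) 𝕜)
    (DE : Fin n → Fin n → Matrix (Fin k) (Fin k) 𝕜) (E V : Fin n → Matrix (Fin k) (Fin k) 𝕜)
    (hF : ∀ i j, F j i = -F i j) (hDF : ∀ l i j, DF l j i = -DF l i j)
    (hB : ∀ i j l, DF i j l + DF j l i + DF l i j = 0) (hE : ∀ j, E j = ∑ i, DF i i j)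
    (X b : Fin n → ℝ) (hV : ∀ j, V j = ∑ l, X l • F l j) (η τ S : ℝ)
    (hS : S = ∑ i, ∑ j, hs (F i j) (F i j)) :
    ∑ i, (4 * ((b i - X i * η) * ∑ j, hs (F i j) (E j)
          + η * ∑ j, (hs (DF i i j) (E j) + hs (F i j) (DE i j)))
        - 4 * ((b i - X i * η) * ∑ l, X l * ∑ j, hs (F l j) (F i j)
          + η * ∑ l, ((if l = i then 1 / (2 * τ) else 0) * ∑ j, hs (F l j) (F i j)
            + X l * ∑ j, (hs (DF i l j) (F i j) + hs (F l j) (DF i i j))))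
        + (((b i - X i * η) * X i + η * (1 / (2 * τ))) * S
          + η * X i * ∑ p, ∑ q, (hs (DF i p q) (F p q) + hs (F p q) (DF i p q))))
      = 4 * ∑ j, hs (∑ i, b i • F i j) (E j - V j) + 4 * η * ∑ j, hs (E j - V j) (E j - V j)
        + (4 * η * ∑ i, ∑ j, hs (F i j) (DE i j)
          + ((n / 2 - 2) / τ - ∑ i, X i ^ 2) * η * S) + (∑ i, b i * X i) * S := by
  -- In the application η = ψ² w, and `b i - X i * η` is ∂_i η, with `b` the part in which the
  -- cutoff is differentiated; the `if` is ∂_i X_l.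
  have hVsum : ∀ (M : Fin n → Matrix (Fin k) (Fin k) 𝕜) (a : Fin n → ℝ),
      ∑ j, hs (∑ i, a i • F i j) (M j) = ∑ i, a i * ∑ j, hs (F i j) (M j) := by
    intro M a
    simp only [hs_sum_left, hs_smul_left, Finset.mul_sum]
    exact Finset.sum_comm
  have hfV : ∀ i, ∑ l, X l * ∑ j, hs (F l j) (F i j) = ∑ j, hs (F i j) (V j) := by
    intro i
    rw [← hVsum (fun j => F i j)]
    simp only [hs_comm (F i _), hV]
  have hVE : ∑ j, hs (V j) (E j) = ∑ i, X i * ∑ j, hs (F i j) (E j) := by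
    rw [← hVsum]
    simp only [hV]
  have hVV : ∑ j, hs (V j) (V j) = ∑ i, X i * ∑ j, hs (F i j) (V j) := by
    rw [← hVsum]
    simp only [hV]
  have hEE : ∑ i, ∑ j, hs (DF i i j) (E j) = ∑ j, hs (E j) (E j) := by
    rw [Finset.sum_comm]
    simp only [← hs_sum_left, ← hE]
  -- The only use of Bianchi. This term cancels the derivative of |F|² in the last summand of the
  -- field, which fixes the ratio 4 : 1 of the coefficients.
  have hK : ∑ i, ∑ l, X l * ∑ j, hs (DF i l j) (F i j)
      = ∑ i, X i * ((1 / 2) * ∑ p, ∑ q, hs (DF i p q) (F p q)) := by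
    rw [Finset.sum_comm]
    refine Finset.sum_congr rfl fun l _ => ?_
    rw [← Finset.mul_sum, ← two_mul_sum_hs_of_bianchi F DF hF hDF hB l]
    ring
  have hQ : ∑ i, ∑ l, X l * ∑ j, hs (F l j) (DF i i j) = ∑ j, hs (V j) (E j) := by
    rw [hVE, Finset.sum_comm]
    refine Finset.sum_congr rfl fun l _ => ?_
    rw [← Finset.mul_sum, Finset.sum_comm]
    simp only [← hs_sum_right, ← hE]
  have hterm : ∀ i, (4 * ((b i - X i * η) * ∑ j, hs (F i j) (E j)
          + η * ∑ j, (hs (DF i i j) (E j) + hs (F i j) (DE i j)))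
        - 4 * ((b i - X i * η) * ∑ l, X l * ∑ j, hs (F l j) (F i j)
          + η * ∑ l, ((if l = i then 1 / (2 * τ) else 0) * ∑ j, hs (F l j) (F i j)
            + X l * ∑ j, (hs (DF i l j) (F i j) + hs (F l j) (DF i i j))))
        + (((b i - X i * η) * X i + η * (1 / (2 * τ))) * S
          + η * X i * ∑ p, ∑ q, (hs (DF i p q) (F p q) + hs (F p q) (DF i p q))))
      = 4 * (b i * ∑ j, hs (F i j) (E j)) - 4 * η * (X i * ∑ j, hs (F i j) (E j))
        + 4 * η * (∑ j, hs (DF i i j) (E j)) + 4 * η * ∑ j, hs (F i j) (DE i j)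
        - 4 * (b i * ∑ j, hs (F i j) (V j)) + 4 * η * (X i * ∑ j, hs (F i j) (V j))
        - 4 * η * (1 / (2 * τ)) * (∑ j, hs (F i j) (F i j))
        - 4 * η * (∑ l, X l * ∑ j, hs (DF i l j) (F i j))
        - 4 * η * (∑ l, X l * ∑ j, hs (F l j) (DF i i j))
        + S * (b i * X i) - S * η * (X i ^ 2) + η * (1 / (2 * τ)) * S
        + 4 * η * (X i * ((1 / 2) * ∑ p, ∑ q, hs (DF i p q) (F p q))) := by
    intro i
    have h1 : ∑ p, ∑ q, (hs (DF i p q) (F p q) + hs (F p q) (DF i p q))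
        = 2 * ∑ p, ∑ q, hs (DF i p q) (F p q) := by
      simp only [hs_comm (F _ _) (DF _ _ _), ← two_mul, Finset.mul_sum]
    have h2 : ∑ l, ((if l = i then 1 / (2 * τ) else 0) * ∑ j, hs (F l j) (F i j)
        + X l * ∑ j, (hs (DF i l j) (F i j) + hs (F l j) (DF i i j)))
        = (1 / (2 * τ)) * (∑ j, hs (F i j) (F i j))
          + (∑ l, X l * ∑ j, hs (DF i l j) (F i j))
          + ∑ l, X l * ∑ j, hs (F l j) (DF i i j) := by
      simp only [Finset.sum_add_distrib, mul_add, ite_mul, zero_mul, Finset.sum_ite_eq',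
        Finset.mem_univ, if_true, add_assoc]
    rw [h1, h2, hfV, Finset.sum_add_distrib]
    ring
  rw [Finset.sum_congr rfl fun i _ => hterm i]
  simp only [Finset.sum_add_distrib, Finset.sum_sub_distrib, ← Finset.mul_sum]
  rw [hK, hQ, ← hVE, ← hVV, hEE, ← hS, hVsum]
  -- The trace of ∂X contributes n/(2τ) and the contraction of ∂X with F contributes −4/(2τ);
  -- together they give (n/2 − 2)/τ.
  simp only [hs_sub_left, hs_sub_right, Finset.sum_sub_distrib, mul_sub, hs_comm (E _) (V _),
    Finset.sum_const, Finset.card_univ, Fintype.card_fin, nsmul_eq_mul]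
  ring

/-- Young's inequality for the terms of the divergence identity in which the cutoff is
differentiated. -/
theorem divergence_error_le (F : Fin n → Fin n → Matrix (Fin k) (Fin k) 𝕜)
    (D : Fin n → Matrix (Fin k) (Fin k) 𝕜) (X g : Fin n → ℝ) (ψ w S : ℝ) (hw : 0 ≤ w)
    (hS : S = ∑ i, ∑ j, hs (F i j) (F i j)) :
    -(4 * ∑ j, hs (∑ i, (2 * ψ * g i * w) • F i j) (D j) + 4 * (ψ ^ 2 * w) * ∑ j, hs (D j) (D j)
        + (∑ i, (2 * ψ * g i * w) * X i) * S)
      ≤ w * (4 * ∑ i, g i ^ 2 + 2 * |ψ| * |∑ i, g i * X i|) * S := by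
  have hS0 : 0 ≤ S := by
    rw [hS]
    exact Finset.sum_nonneg fun i _ => Finset.sum_nonneg fun j _ => hs_self_nonneg _
  have h1 : ∀ j, ∑ i, (2 * ψ * g i * w) • F i j = (2 * ψ * w) • ∑ i, g i • F i j := by
    intro j
    simp only [Finset.smul_sum, smul_smul]
    exact Finset.sum_congr rfl fun i _ => by ring_nf
  have h2 : ∑ i, (2 * ψ * g i * w) * X i = (2 * ψ * w) * ∑ i, g i * X i := by
    rw [Finset.mul_sum]
    exact Finset.sum_congr rfl fun i _ => by ring
  have h3 : ∀ j, -(2 * ψ * hs (∑ i, g i • F i j) (D j)) - ψ ^ 2 * hs (D j) (D j)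
      ≤ (∑ i, g i ^ 2) * ∑ i, hs (F i j) (F i j) := by
    intro j
    refine le_trans ?_ (hs_sum_smul_self_le Finset.univ g fun i => F i j)
    -- Expanding this square absorbs the cross term. It is available because the cutoff enters the
    -- weight squared: its gradient then carries a factor ψ.
    have := hs_self_nonneg (∑ i, g i • F i j + ψ • D j)
    simp only [hs_add_left, hs_add_right, hs_smul_left, hs_smul_right,
      hs_comm (D j) (∑ i, g i • F i j)] at this
    linarith
  have h4 : ∑ j, (-(2 * ψ * hs (∑ i, g i • F i j) (D j)) - ψ ^ 2 * hs (D j) (D j))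
      ≤ (∑ i, g i ^ 2) * S := by
    refine (Finset.sum_le_sum fun j _ => h3 j).trans_eq ?_
    rw [← Finset.mul_sum, hS, Finset.sum_comm]
  simp only [h1, h2, hs_smul_left, ← Finset.mul_sum]
  simp only [Finset.sum_sub_distrib, Finset.sum_neg_distrib, ← Finset.mul_sum] at h4
  have h5 := mul_le_mul_of_nonneg_left h4 (by positivity : 0 ≤ 4 * w)
  have h6 : -(ψ * ∑ i, g i * X i) ≤ |ψ| * |∑ i, g i * X i| := by
    rw [← abs_mul]
    exact neg_le_abs _
  have h7 := mul_le_mul_of_nonneg_left h6 (by positivity : 0 ≤ 2 * w * S)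
  nlinarith [h5, h7]

end YangMills

/-! ### Integration by parts against the localised Gaussian. -/

namespace YangMills

open MeasureTheory

variable {𝕜 : Type*} [RCLike 𝕜] {n k : ℕ}

/-- The integral of a partial derivative of a compactly supported function vanishes. -/
theorem integral_fderiv_apply_eq_zero {f : EuclideanSpace ℝ (Fin n) → ℝ} (hf : ContDiff ℝ ∞ f)
    (hc : HasCompactSupport f) (v : EuclideanSpace ℝ (Fin n)) : ∫ x, fderiv ℝ f x v = 0 := by
  have hd : Integrable fun x => fderiv ℝ f x v :=
    ((hf.continuous_fderiv (by simp)).clm_apply continuous_const).integrable_of_hasCompactSupport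
      (hc.fderiv_apply (𝕜 := ℝ) v)
  have hi : Integrable f := hf.continuous.integrable_of_hasCompactSupport hc
  -- Integration by parts against the constant function 1.
  have h := integral_mul_fderiv_eq_neg_fderiv_mul_of_integrable (μ := volume) (f := f)
    (g := fun _ => (1 : ℝ)) (v := v) (by simpa using hd) (by simp) (by simpa using hi)
    (fun x _ => hf.differentiable (by simp) x) (fun x _ => by fun_prop)
  simpa using h

/-- The derivative of a function along a coordinate line. -/
theorem hasDerivAt_coordinateLine {f : EuclideanSpace ℝ (Fin n) → ℝ} (hf : ContDiff ℝ ∞ f)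
    (i : Fin n) (x : EuclideanSpace ℝ (Fin n)) :
    HasDerivAt (fun s : ℝ => f (x + s • EuclideanSpace.single i (1 : ℝ)))
      (fderiv ℝ f x (EuclideanSpace.single i 1)) 0 :=
  (hf.differentiable (by simp) x).hasFDerivAt.hasLineDerivAt _

/-- The Gaussian `c exp (-|x - x₀|² / 4τ)`. -/
noncomputable def gaussianWeight (c τ : ℝ) (x₀ x : EuclideanSpace ℝ (Fin n)) : ℝ :=
  c * Real.exp (-‖x - x₀‖ ^ 2 / (4 * τ))

theorem contDiff_gaussianWeight (c τ : ℝ) (x₀ : EuclideanSpace ℝ (Fin n)) :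
    ContDiff ℝ ∞ (gaussianWeight c τ x₀) := by
  have h : ContDiff ℝ ∞ fun x : EuclideanSpace ℝ (Fin n) => ‖x - x₀‖ ^ 2 :=
    (contDiff_id.sub contDiff_const).norm_sq ℝ
  exact contDiff_const.mul (h.neg.div_const _).exp

theorem hasDerivAt_norm_sub_sq (x₀ x : EuclideanSpace ℝ (Fin n)) (i : Fin n) :
    HasDerivAt (fun s : ℝ => ‖x + s • EuclideanSpace.single i (1 : ℝ) - x₀‖ ^ 2)
      (2 * (x i - x₀ i)) 0 := by
  have h : HasDerivAt (fun s : ℝ => x + s • EuclideanSpace.single i (1 : ℝ) - x₀)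
      (EuclideanSpace.single i (1 : ℝ)) 0 := by
    simpa using (((hasDerivAt_id (0 : ℝ)).smul_const
      (EuclideanSpace.single i (1 : ℝ))).const_add x).sub_const x₀
  have h2 := h.norm_sq
  simpa [EuclideanSpace.inner_single_right] using h2

theorem hasDerivAt_gaussianWeight (c τ : ℝ) (x₀ x : EuclideanSpace ℝ (Fin n)) (i : Fin n) :
    HasDerivAt (fun s : ℝ => gaussianWeight c τ x₀ (x + s • EuclideanSpace.single i (1 : ℝ)))
      (-((x i - x₀ i) / (2 * τ)) * gaussianWeight c τ x₀ x) 0 := by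
  have h := (((hasDerivAt_norm_sub_sq x₀ x i).neg.div_const (4 * τ)).exp).const_mul c
  simp only [Pi.neg_apply, zero_smul, add_zero] at h
  refine h.congr_deriv ?_
  unfold gaussianWeight
  -- For τ = 0, division by zero makes the exponent and the factor on the right vanish, so both
  -- sides are derivatives of a constant.
  rcases eq_or_ne τ 0 with rfl | hτ
  · simp
  · field_simp
    ring

theorem hasDerivAt_coordinate (x₀ x : EuclideanSpace ℝ (Fin n)) (τ : ℝ) (i l : Fin n) :
    HasDerivAt (fun s : ℝ => ((x + s • EuclideanSpace.single i (1 : ℝ)) l - x₀ l) / (2 * τ))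
      (if l = i then 1 / (2 * τ) else 0) 0 := by
  have h : HasDerivAt (fun s : ℝ => (x + s • EuclideanSpace.single i (1 : ℝ)) l)
      (if l = i then 1 else 0) 0 := by
    have := ((hasDerivAt_id (0 : ℝ)).mul_const (if l = i then (1 : ℝ) else 0)).const_add (x l)
    simpa using this
  refine ((h.sub_const (x₀ l)).div_const (2 * τ)).congr_deriv ?_
  split_ifs <;> simp

namespace MetricConnection

variable (A : MetricConnection 𝕜 n k)

/-- The vector field whose divergence appears in the monotonicity formula. -/
noncomputable def monotonicityField (x₀ : EuclideanSpace ℝ (Fin n)) (τ : ℝ)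
    (η : EuclideanSpace ℝ (Fin n) → ℝ) (i : Fin n) (x : EuclideanSpace ℝ (Fin n)) : ℝ :=
  4 * (η x * ∑ j, hs (A.curvature i j x) (A.divCurvature j x))
    - 4 * (η x * ∑ l, (x l - x₀ l) / (2 * τ) * ∑ j, hs (A.curvature l j x) (A.curvature i j x))
    + η x * ((x i - x₀ i) / (2 * τ)) * A.curvatureNormSq x

theorem contDiff_monotonicityField (x₀ : EuclideanSpace ℝ (Fin n)) (τ : ℝ)
    {η : EuclideanSpace ℝ (Fin n) → ℝ} (hη : ContDiff ℝ ∞ η) (i : Fin n) :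
    ContDiff ℝ ∞ (A.monotonicityField x₀ τ η i) := by
  have hX : ∀ l : Fin n, ContDiff ℝ ∞ fun x : EuclideanSpace ℝ (Fin n) =>
      (x l - x₀ l) / (2 * τ) := fun l => by fun_prop
  exact ((contDiff_const.mul (hη.mul (ContDiff.sum fun j _ =>
    (A.matSmooth_curvature i j).hs (A.matSmooth_divCurvature j)))).sub
    (contDiff_const.mul (hη.mul (ContDiff.sum fun l _ => (hX l).mul (ContDiff.sum fun j _ =>
      (A.matSmooth_curvature l j).hs (A.matSmooth_curvature i j)))))).add
    ((hη.mul (hX i)).mul A.contDiff_curvatureNormSq)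

/-- The spatial part of the evolution of the weighted energy density: up to a nonnegative term it
is a divergence plus terms containing derivatives of the cutoff `ψ`. -/
theorem energy_density_le {x₀ : EuclideanSpace ℝ (Fin n)} {c τ : ℝ} (hc : 0 ≤ c)
    {ψ : EuclideanSpace ℝ (Fin n) → ℝ} (hψ : ContDiff ℝ ∞ ψ) (x : EuclideanSpace ℝ (Fin n)) :
    4 * (ψ x ^ 2 * gaussianWeight c τ x₀ x)
        * ∑ i, ∑ j, hs (A.curvature i j x) (A.covDeriv i (A.divCurvature j) x)
      + ((n / 2 - 2) / τ - ∑ i, ((x i - x₀ i) / (2 * τ)) ^ 2)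
        * (ψ x ^ 2 * gaussianWeight c τ x₀ x) * A.curvatureNormSq x
    ≤ ∑ i, fderiv ℝ (A.monotonicityField x₀ τ
          (fun x => ψ x ^ 2 * gaussianWeight c τ x₀ x) i) x (EuclideanSpace.single i 1)
      + gaussianWeight c τ x₀ x * (4 * ∑ i, fderiv ℝ ψ x (EuclideanSpace.single i 1) ^ 2
        + 2 * |ψ x| * |∑ i, fderiv ℝ ψ x (EuclideanSpace.single i 1)
          * ((x i - x₀ i) / (2 * τ))|) * A.curvatureNormSq x := by
  set w := gaussianWeight c τ x₀ with hw
  set g : Fin n → ℝ := fun i => fderiv ℝ ψ x (EuclideanSpace.single i 1) with hg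
  set X : Fin n → ℝ := fun i => (x i - x₀ i) / (2 * τ) with hX
  have hηs : ContDiff ℝ ∞ fun x => ψ x ^ 2 * w x := (hψ.pow 2).mul (contDiff_gaussianWeight c τ x₀)
  have hw0 : 0 ≤ w x := mul_nonneg hc (Real.exp_pos _).le
  -- The cutoff part and the Gaussian part of ∂_i η are kept apart, since only the former is an
  -- error term.
  have hη : ∀ i, HasDerivAt (fun s : ℝ => ψ (x + s • EuclideanSpace.single i (1 : ℝ)) ^ 2
      * w (x + s • EuclideanSpace.single i (1 : ℝ)))
      (2 * ψ x * g i * w x - X i * (ψ x ^ 2 * w x)) 0 := by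
    intro i
    have h := ((hasDerivAt_coordinateLine hψ i x).pow 2).mul (hasDerivAt_gaussianWeight c τ x₀ x i)
    simp only [zero_smul, add_zero, Pi.pow_apply] at h
    refine h.congr_deriv ?_
    simp only [hg, hX, ← hw]
    ring
  -- Product rule for the field, with ∂ replaced by ∇ inside `hs`, in the shape of the left side of
  -- `divergence_identity`.
  have hY : ∀ i, fderiv ℝ (A.monotonicityField x₀ τ (fun x => ψ x ^ 2 * w x) i) x
      (EuclideanSpace.single i 1) =
      (4 * ((2 * ψ x * g i * w x - X i * (ψ x ^ 2 * w x))
            * ∑ j, hs (A.curvature i j x) (A.divCurvature j x)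
          + (ψ x ^ 2 * w x) * ∑ j, (hs (A.covDeriv i (A.curvature i j) x) (A.divCurvature j x)
            + hs (A.curvature i j x) (A.covDeriv i (A.divCurvature j) x)))
        - 4 * ((2 * ψ x * g i * w x - X i * (ψ x ^ 2 * w x))
            * ∑ l, X l * ∑ j, hs (A.curvature l j x) (A.curvature i j x)
          + (ψ x ^ 2 * w x) * ∑ l, ((if l = i then 1 / (2 * τ) else 0)
              * ∑ j, hs (A.curvature l j x) (A.curvature i j x)
            + X l * ∑ j, (hs (A.covDeriv i (A.curvature l j) x) (A.curvature i j x)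
              + hs (A.curvature l j x) (A.covDeriv i (A.curvature i j) x))))
        + (((2 * ψ x * g i * w x - X i * (ψ x ^ 2 * w x)) * X i
            + (ψ x ^ 2 * w x) * (1 / (2 * τ))) * A.curvatureNormSq x
          + (ψ x ^ 2 * w x) * X i * ∑ p, ∑ q,
            (hs (A.covDeriv i (A.curvature p q) x) (A.curvature p q x)
              + hs (A.curvature p q x) (A.covDeriv i (A.curvature p q) x)))) := by
    intro i
    refine (hasDerivAt_coordinateLine (A.contDiff_monotonicityField x₀ τ hηs i) i x).unique ?_
    have hF := fun p q => A.matSmooth_curvature p q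
    have hE := fun j => A.matSmooth_divCurvature j
    have h1 := (hη i).mul (HasDerivAt.fun_sum (u := Finset.univ) fun j _ =>
      A.hasDerivAt_hs (hF i j) (hE j) i x)
    have h2 := (hη i).mul (HasDerivAt.fun_sum (u := Finset.univ) fun l _ =>
      (hasDerivAt_coordinate x₀ x τ i l).mul (HasDerivAt.fun_sum (u := Finset.univ) fun j _ =>
        A.hasDerivAt_hs (hF l j) (hF i j) i x))
    have h3 := ((hη i).mul (hasDerivAt_coordinate x₀ x τ i i)).mul
      (HasDerivAt.fun_sum (u := Finset.univ) fun p _ =>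
        HasDerivAt.fun_sum (u := Finset.univ) fun q _ => A.hasDerivAt_hs (hF p q) (hF p q) i x)
    have h := ((h1.const_mul 4).sub (h2.const_mul 4)).add h3
    simp only [zero_smul, add_zero, if_true, ← curvatureNormSq_eq, Pi.mul_apply] at h
    exact h
  have hid := divergence_identity (fun i j => A.curvature i j x)
    (fun l i j => A.covDeriv l (A.curvature i j) x)
    (fun i j => A.covDeriv i (A.divCurvature j) x) (fun j => A.divCurvature j x)
    (fun j => ∑ l, X l • A.curvature l j x) (fun i j => A.curvature_antisymm i j x)
    (fun l i j => A.covDeriv_curvature_antisymm l i j x) (fun i j l => A.bianchi i j l x)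
    (fun j => rfl) X (fun i => 2 * ψ x * g i * w x) (fun j => rfl) (ψ x ^ 2 * w x) τ
    (A.curvatureNormSq x) (A.curvatureNormSq_eq x)
  have herr := divergence_error_le (fun i j => A.curvature i j x)
    (fun j => A.divCurvature j x - ∑ l, X l • A.curvature l j x) X g (ψ x) (w x)
    (A.curvatureNormSq x) hw0 (A.curvatureNormSq_eq x)
  rw [Finset.sum_congr rfl fun i _ => hY i, hid]
  linarith [herr]

/-- The integrated form of `energy_density_le`. -/
theorem integral_energy_density_le {x₀ : EuclideanSpace ℝ (Fin n)} {c τ : ℝ} (hc : 0 ≤ c)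
    {ψ : EuclideanSpace ℝ (Fin n) → ℝ} (hψ : ContDiff ℝ ∞ ψ) (hs' : HasCompactSupport ψ) :
    ∫ x, (4 * (ψ x ^ 2 * gaussianWeight c τ x₀ x)
        * ∑ i, ∑ j, hs (A.curvature i j x) (A.covDeriv i (A.divCurvature j) x)
      + ((n / 2 - 2) / τ - ∑ i, ((x i - x₀ i) / (2 * τ)) ^ 2)
        * (ψ x ^ 2 * gaussianWeight c τ x₀ x) * A.curvatureNormSq x)
    ≤ ∫ x, gaussianWeight c τ x₀ x * (4 * ∑ i, fderiv ℝ ψ x (EuclideanSpace.single i 1) ^ 2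
        + 2 * |ψ x| * |∑ i, fderiv ℝ ψ x (EuclideanSpace.single i 1)
          * ((x i - x₀ i) / (2 * τ))|) * A.curvatureNormSq x := by
  have hηs : ContDiff ℝ ∞ fun x => ψ x ^ 2 * gaussianWeight c τ x₀ x :=
    (hψ.pow 2).mul (contDiff_gaussianWeight c τ x₀)
  have hψ0 : ∀ x, x ∉ tsupport ψ → ψ x = 0 := fun x hx => image_eq_zero_of_notMem_tsupport hx
  have hdψ0 : ∀ x, x ∉ tsupport ψ → fderiv ℝ ψ x = 0 := fun x hx =>
    image_eq_zero_of_notMem_tsupport fun h => hx (tsupport_fderiv_subset ℝ h)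
  have hYs := fun i => A.contDiff_monotonicityField x₀ τ hηs i
  have hYc : ∀ i, HasCompactSupport (A.monotonicityField x₀ τ
      (fun x => ψ x ^ 2 * gaussianWeight c τ x₀ x) i) := fun i =>
    HasCompactSupport.intro hs' fun x hx => by simp [monotonicityField, hψ0 x hx]
  have hYi : ∀ i, Integrable fun x => fderiv ℝ (A.monotonicityField x₀ τ
      (fun x => ψ x ^ 2 * gaussianWeight c τ x₀ x) i) x (EuclideanSpace.single i 1) := fun i =>
    (((hYs i).continuous_fderiv (by simp)).clm_apply
      continuous_const).integrable_of_hasCompactSupport ((hYc i).fderiv_apply (𝕜 := ℝ) _)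
  have hS : Continuous A.curvatureNormSq := A.contDiff_curvatureNormSq.continuous
  have hwc : Continuous (gaussianWeight c τ x₀) := (contDiff_gaussianWeight c τ x₀).continuous
  have hψc : Continuous ψ := hψ.continuous
  have hg : ∀ i : Fin n, Continuous fun x => fderiv ℝ ψ x (EuclideanSpace.single i 1) := fun i =>
    (hψ.continuous_fderiv (by simp)).clm_apply continuous_const
  have hFE : Continuous fun x =>
      ∑ i, ∑ j, hs (A.curvature i j x) (A.covDeriv i (A.divCurvature j) x) :=
    continuous_finsetSum _ fun i _ => continuous_finsetSum _ fun j _ =>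
      ((A.matSmooth_curvature i j).hs
        (A.matSmooth_covDeriv (A.matSmooth_divCurvature j) i)).continuous
  have hL : Integrable fun x => 4 * (ψ x ^ 2 * gaussianWeight c τ x₀ x)
        * ∑ i, ∑ j, hs (A.curvature i j x) (A.covDeriv i (A.divCurvature j) x)
      + ((n / 2 - 2) / τ - ∑ i, ((x i - x₀ i) / (2 * τ)) ^ 2)
        * (ψ x ^ 2 * gaussianWeight c τ x₀ x) * A.curvatureNormSq x := by
    refine Continuous.integrable_of_hasCompactSupport (by fun_prop)
      (HasCompactSupport.intro hs' fun x hx => ?_)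
    simp [hψ0 x hx]
  have hR : Integrable fun x => gaussianWeight c τ x₀ x
      * (4 * ∑ i, fderiv ℝ ψ x (EuclideanSpace.single i 1) ^ 2
        + 2 * |ψ x| * |∑ i, fderiv ℝ ψ x (EuclideanSpace.single i 1)
          * ((x i - x₀ i) / (2 * τ))|) * A.curvatureNormSq x := by
    refine Continuous.integrable_of_hasCompactSupport (by fun_prop)
      (HasCompactSupport.intro hs' fun x hx => ?_)
    simp [hdψ0 x hx]
  refine (integral_mono hL ((integrable_finsetSum _ fun i _ => hYi i).add hR)
    fun x => A.energy_density_le hc hψ x).trans_eq ?_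
  rw [integral_add' (integrable_finsetSum _ fun i _ => hYi i) hR,
    integral_finsetSum _ fun i _ => hYi i]
  simp [integral_fderiv_apply_eq_zero (hYs _) (hYc _)]

end MetricConnection

end YangMills

/-! ### Calculus on space-time and the evolution of the energy density. -/

namespace YangMills

open MeasureTheory Topology

section SpaceTime

variable {X G : Type*} [NormedAddCommGroup X] [NormedSpace ℝ X] [NormedAddCommGroup G]
  [NormedSpace ℝ G] {f : ℝ × X → G} {J : Set ℝ}

/-- Spatial derivatives of a function that is smooth on `J × X` are smooth on `J × X`. -/
theorem contDiffOn_spatial_fderiv (hJ : UniqueDiffOn ℝ J) (hf : ContDiffOn ℝ ∞ f (J ×ˢ Set.univ))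
    (v : X) : ContDiffOn ℝ ∞ (fun q : ℝ × X => fderiv ℝ (fun y => f (q.1, y)) q.2 v)
      (J ×ˢ Set.univ) := by
  have hS : UniqueDiffOn ℝ (J ×ˢ (Set.univ : Set X)) := hJ.prod uniqueDiffOn_univ
  have h1 : ContDiffOn ℝ ∞ (fun q => fderivWithin ℝ f (J ×ˢ Set.univ) q ((0 : ℝ), v))
      (J ×ˢ Set.univ) :=
    (hf.fderivWithin hS (m := ∞) (by simp)).clm_apply contDiffOn_const
  -- Each time slice is the whole of X, so the within-derivative in direction (0, v) is a genuine
  -- spatial derivative, even at an endpoint of J.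
  refine h1.congr fun q hq => ?_
  have h2 : HasFDerivWithinAt f (fderivWithin ℝ f (J ×ˢ Set.univ) q) (J ×ˢ Set.univ) (q.1, q.2) :=
    (hf.differentiableOn (by simp) q hq).hasFDerivWithinAt
  have h3 : HasFDerivWithinAt (fun y : X => (q.1, y)) (ContinuousLinearMap.inr ℝ ℝ X) Set.univ q.2 :=
    (hasFDerivAt_prodMk_right q.1 q.2).hasFDerivWithinAt
  have h4 := (h2.comp q.2 h3 fun y _ => ⟨hq.1, trivial⟩).hasFDerivAt Filter.univ_mem
  have h5 : HasFDerivAt (fun y => f (q.1, y))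
    ((fderivWithin ℝ f (J ×ˢ Set.univ) q).comp (ContinuousLinearMap.inr ℝ ℝ X)) q.2 := h4
  rw [h5.fderiv]
  simp

/-- Time and space derivatives of a smooth function on space-time commute. -/
theorem hasDerivAt_spatial_fderiv {t : ℝ} (hJ : J ∈ 𝓝 t) (hf : ContDiffOn ℝ ∞ f (J ×ˢ Set.univ))
    (x v : X) : HasDerivAt (fun s => fderiv ℝ (fun y => f (s, y)) x v)
      (fderiv ℝ (fun y => deriv (fun s => f (s, y)) t) x v) t := by
  have hat : ∀ s ∈ interior J, ∀ y, ContDiffAt ℝ ∞ f (s, y) := fun s hs y =>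
    hf.contDiffAt (prod_mem_nhds (mem_interior_iff_mem_nhds.1 hs) Filter.univ_mem)
  have ht : t ∈ interior J := mem_interior_iff_mem_nhds.2 hJ
  have hd : ∀ s ∈ interior J, ∀ y, HasFDerivAt f (fderiv ℝ f (s, y)) (s, y) := fun s hs y =>
    ((hat s hs y).differentiableAt (by simp)).hasFDerivAt
  have h1 : ∀ s ∈ interior J, ∀ y, fderiv ℝ (fun y => f (s, y)) y v
      = fderiv ℝ f (s, y) ((0 : ℝ), v) := by
    intro s hs y
    have h : HasFDerivAt (fun y => f (s, y))
      ((fderiv ℝ f (s, y)).comp (ContinuousLinearMap.inr ℝ ℝ X)) y :=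
      (hd s hs y).comp y (hasFDerivAt_prodMk_right s y)
    rw [h.fderiv]
    simp
  have h2 : ∀ y, deriv (fun s => f (s, y)) t = fderiv ℝ f (t, y) ((1 : ℝ), (0 : X)) := by
    intro y
    have h : HasFDerivAt (fun s => f (s, y))
      ((fderiv ℝ f (t, y)).comp (ContinuousLinearMap.inl ℝ ℝ X)) t :=
      (hd t ht y).comp t (hasFDerivAt_prodMk_left t y)
    rw [h.hasDerivAt.deriv]
    simp
  have hdd : HasFDerivAt (fderiv ℝ f) (fderiv ℝ (fderiv ℝ f) (t, x)) (t, x) :=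
    (((hat t ht x).fderiv_right (m := 1) (by norm_cast)).differentiableAt
      (by simp)).hasFDerivAt
  -- Both mixed derivatives are the second derivative of f on (1, 0) and (0, v), taken in the two
  -- orders.
  have hsymm : IsSymmSndFDerivAt ℝ f (t, x) :=
    (contDiffAt_infty.1 (hat t ht x) 2).isSymmSndFDerivAt (by simp)
  have h3 : HasFDerivAt (fun y => fderiv ℝ f (t, y) ((1 : ℝ), (0 : X)))
      ((ContinuousLinearMap.apply ℝ G ((1 : ℝ), (0 : X))).comp
        ((fderiv ℝ (fderiv ℝ f) (t, x)).comp (ContinuousLinearMap.inr ℝ ℝ X))) x :=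
    (ContinuousLinearMap.apply ℝ G ((1 : ℝ), (0 : X))).hasFDerivAt.comp x
      (hdd.comp x (hasFDerivAt_prodMk_right t x))
  have h4 : HasFDerivAt (fun s => fderiv ℝ f (s, x) ((0 : ℝ), v))
      ((ContinuousLinearMap.apply ℝ G ((0 : ℝ), v)).comp
        ((fderiv ℝ (fderiv ℝ f) (t, x)).comp (ContinuousLinearMap.inl ℝ ℝ X))) t :=
    (ContinuousLinearMap.apply ℝ G ((0 : ℝ), v)).hasFDerivAt.comp t
      (hdd.comp t (hasFDerivAt_prodMk_left t x))
  have h5 : (fun s => fderiv ℝ (fun y => f (s, y)) x v)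
      =ᶠ[𝓝 t] fun s => fderiv ℝ f (s, x) ((0 : ℝ), v) := by
    filter_upwards [isOpen_interior.mem_nhds ht] with s hs using h1 s hs x
  simp only [h2]
  refine (h4.hasDerivAt.congr_deriv ?_).congr_of_eventuallyEq h5
  rw [h3.fderiv]
  simpa using hsymm ((1 : ℝ), (0 : X)) ((0 : ℝ), v)

/-- Differentiation under the integral sign for smooth functions on space-time whose support is
bounded in space. -/
theorem hasDerivAt_integral_of_contDiffOn [FiniteDimensional ℝ X] [MeasurableSpace X]
    [BorelSpace X] {μ : Measure X} [IsFiniteMeasureOnCompacts μ] {g : ℝ × X → ℝ} {K : Set X}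
    (hK : IsCompact K) (hJ : IsOpen J) (hg : ContDiffOn ℝ ∞ g (J ×ˢ Set.univ))
    (h0 : ∀ s, ∀ x ∉ K, g (s, x) = 0) {t : ℝ} (ht : t ∈ J) :
    HasDerivAt (fun s => ∫ x, g (s, x) ∂μ) (∫ x, deriv (fun s => g (s, x)) t ∂μ) t := by
  have hS : IsOpen (J ×ˢ (Set.univ : Set X)) := hJ.prod isOpen_univ
  have hd : ∀ s ∈ J, ∀ x, HasDerivAt (fun s => g (s, x))
      (fderiv ℝ g (s, x) ((1 : ℝ), (0 : X))) s := by
    intro s hs x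
    have h1 : HasFDerivAt g (fderiv ℝ g (s, x)) (s, x) :=
      ((hg.contDiffAt (hS.mem_nhds ⟨hs, trivial⟩)).differentiableAt (by simp)).hasFDerivAt
    have h2 : HasFDerivAt (fun s => g (s, x))
      ((fderiv ℝ g (s, x)).comp (ContinuousLinearMap.inl ℝ ℝ X)) s :=
      h1.comp s (hasFDerivAt_prodMk_left s x)
    simpa using h2.hasDerivAt
  have hcont : ContinuousOn (fun q : ℝ × X => fderiv ℝ g q ((1 : ℝ), (0 : X)))
      (J ×ˢ Set.univ) :=
    (hg.continuousOn_fderiv_of_isOpen hS (by simp)).clm_apply continuousOn_const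
  -- The time derivative is bounded on the compact set L × K and zero for x outside K, so a multiple
  -- of the indicator of K dominates it near t.
  obtain ⟨L, hL, hLc, hLJ⟩ := exists_mem_nhds_isCompact_mapsTo continuous_id (hJ.mem_nhds ht)
  have hLJ' : L ⊆ J := hLJ
  obtain ⟨C, hC⟩ := (hLc.prod hK).exists_bound_of_continuousOn
    (hcont.mono (Set.prod_mono hLJ' (Set.subset_univ K)))
  have hcs : ∀ s ∈ J, Continuous fun x => g (s, x) := fun s hs =>
    hg.continuousOn.comp_continuous (by fun_prop) fun x => ⟨hs, trivial⟩
  have hsupp : ∀ s, HasCompactSupport fun x => g (s, x) := fun s =>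
    HasCompactSupport.intro hK fun x hx => h0 s x hx
  have hKm : MeasurableSet K := hK.isClosed.measurableSet
  have key := hasDerivAt_integral_of_dominated_loc_of_deriv_le (μ := μ) (x₀ := t) hL
    (F := fun s x => g (s, x)) (F' := fun s x => deriv (fun s => g (s, x)) s)
    (bound := K.indicator fun _ => C) ?_ ?_ ?_ ?_ ?_ ?_
  · exact key.2
  · filter_upwards [hJ.mem_nhds ht] with s hs using (hcs s hs).aestronglyMeasurable
  · exact (hcs t ht).integrable_of_hasCompactSupport (hsupp t)
  · have : (fun x => deriv (fun s => g (s, x)) t)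
        = fun x => fderiv ℝ g (t, x) ((1 : ℝ), (0 : X)) := funext fun x => (hd t ht x).deriv
    rw [this]
    exact (hcont.comp_continuous (f := fun x => (t, x)) (by fun_prop)
      fun x => ⟨ht, trivial⟩).aestronglyMeasurable
  · refine Filter.Eventually.of_forall fun x s hs => ?_
    by_cases hx : x ∈ K
    · rw [Set.indicator_of_mem hx, (hd s (hLJ' hs) x).deriv]
      exact hC (s, x) ⟨hs, hx⟩
    · simp [Set.indicator_of_notMem hx, h0 _ x hx]
  · exact (integrable_indicator_iff hKm).2 (integrableOn_const hK.measure_lt_top.ne)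
  · refine Filter.Eventually.of_forall fun x s hs => ?_
    rw [(hd s (hLJ' hs) x).deriv]
    exact hd s (hLJ' hs) x

end SpaceTime

variable {𝕜 : Type*} [RCLike 𝕜] {n k : ℕ} {T : EReal} {A : ℝ → MetricConnection 𝕜 n k}

theorem ordConnected_timeInterval (T : EReal) : (timeInterval T).OrdConnected :=
  ⟨fun _ ha _ hb _ hc => ⟨ha.1.trans hc.1, (EReal.coe_le_coe_iff.2 hc.2).trans_lt hb.2⟩⟩

/-- A convex set with interior points has unique derivatives; this covers time 0, where only
one-sided derivatives exist. -/
theorem uniqueDiffOn_timeInterval {t₁ t₂ : ℝ} (h₁ : t₁ ∈ timeInterval T)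
    (h₂ : t₂ ∈ timeInterval T) (h : t₁ < t₂) : UniqueDiffOn ℝ (timeInterval T) := by
  refine uniqueDiffOn_convex (ordConnected_timeInterval T).convex ?_
  have hsub : Set.Ioo t₁ t₂ ⊆ interior (timeInterval T) :=
    interior_maximal (Set.Ioo_subset_Icc_self.trans ((ordConnected_timeInterval T).out h₁ h₂))
      isOpen_Ioo
  exact (Set.nonempty_Ioo.2 h).mono hsub

/-- The velocity of the connection coefficients. -/
theorem IsYangMillsFlow.matHasDerivAt_coeff (hA : IsYangMillsFlow T A) {t : ℝ}
    (ht : timeInterval T ∈ 𝓝 t) (x : EuclideanSpace ℝ (Fin n)) (j : Fin n) :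
    MatHasDerivAt (fun s => (A s).coeff x j) ((A t).divCurvature j x) t := by
  intro β α
  have h := (hA.evolution t (mem_of_mem_nhds ht) x j β α).hasDerivAt ht
  refine h.congr_deriv ?_
  rw [MetricConnection.dStarCurvature, Matrix.neg_apply, neg_neg]
  rfl

/-- The flow equation may be differentiated in space because mixed space-time derivatives commute.
-/
theorem IsYangMillsFlow.matHasDerivAt_partialDeriv_coeff (hA : IsYangMillsFlow T A) {t : ℝ}
    (ht : timeInterval T ∈ 𝓝 t) (x : EuclideanSpace ℝ (Fin n)) (i j : Fin n) :
    MatHasDerivAt (fun s => partialDeriv i (fun y => (A s).coeff y j) x)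
      (partialDeriv i ((A t).divCurvature j) x) t := by
  intro β α
  have h := hasDerivAt_spatial_fderiv ht (hA.smooth j β α) x (EuclideanSpace.single i 1)
  have h2 : (fun y => deriv (fun s => (A s).coeff y j β α) t)
      = fun y => (A t).divCurvature j y β α :=
    funext fun y => (hA.matHasDerivAt_coeff ht y j β α).deriv
  simp only [h2] at h
  exact h

/-- The evolution of the curvature. -/
theorem IsYangMillsFlow.matHasDerivAt_curvature (hA : IsYangMillsFlow T A) {t : ℝ}
    (ht : timeInterval T ∈ 𝓝 t) (x : EuclideanSpace ℝ (Fin n)) (i j : Fin n) :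
    MatHasDerivAt (fun s => (A s).curvature i j x)
      ((A t).covDeriv i ((A t).divCurvature j) x - (A t).covDeriv j ((A t).divCurvature i) x) t := by
  have h := (((hA.matHasDerivAt_partialDeriv_coeff ht x i j).sub
    (hA.matHasDerivAt_partialDeriv_coeff ht x j i)).add
    ((hA.matHasDerivAt_coeff ht x i).mul (hA.matHasDerivAt_coeff ht x j))).sub
    ((hA.matHasDerivAt_coeff ht x j).mul (hA.matHasDerivAt_coeff ht x i))
  have h2 : (A t).covDeriv i ((A t).divCurvature j) x - (A t).covDeriv j ((A t).divCurvature i) x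
      = partialDeriv i ((A t).divCurvature j) x - partialDeriv j ((A t).divCurvature i) x
        + ((A t).divCurvature i x * (A t).coeff x j + (A t).coeff x i * (A t).divCurvature j x)
        - ((A t).divCurvature j x * (A t).coeff x i
          + (A t).coeff x j * (A t).divCurvature i x) := by
    simp only [MetricConnection.covDeriv]
    abel
  rw [h2]
  exact h

/-- The evolution of the energy density. -/
theorem IsYangMillsFlow.hasDerivAt_curvatureNormSq (hA : IsYangMillsFlow T A) {t : ℝ}
    (ht : timeInterval T ∈ 𝓝 t) (x : EuclideanSpace ℝ (Fin n)) :
    HasDerivAt (fun s => (A s).curvatureNormSq x)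
      (4 * ∑ i, ∑ j, hs ((A t).curvature i j x) ((A t).covDeriv i ((A t).divCurvature j) x)) t := by
  have h := HasDerivAt.fun_sum (u := Finset.univ) fun i _ =>
    HasDerivAt.fun_sum (u := Finset.univ) fun j _ =>
      (hA.matHasDerivAt_curvature ht x i j).hs (hA.matHasDerivAt_curvature ht x i j)
  simp only [← MetricConnection.curvatureNormSq_eq] at h
  refine h.congr_deriv ?_
  -- Source of the factor 4: one 2 from differentiating a square, another because the two halves of
  -- ∇_i E_j − ∇_j E_i contribute equally by antisymmetry of F.
  have hswap : ∑ i, ∑ j, hs ((A t).curvature i j x) ((A t).covDeriv j ((A t).divCurvature i) x)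
      = -∑ i, ∑ j, hs ((A t).curvature i j x) ((A t).covDeriv i ((A t).divCurvature j) x) := by
    rw [Finset.sum_comm]
    simp only [← Finset.sum_neg_distrib]
    refine Finset.sum_congr rfl fun i _ => Finset.sum_congr rfl fun j _ => ?_
    rw [(A t).curvature_antisymm i j x, hs_neg_left]
  have hc : ∀ i j, hs ((A t).covDeriv i ((A t).divCurvature j) x
      - (A t).covDeriv j ((A t).divCurvature i) x) ((A t).curvature i j x)
      = hs ((A t).curvature i j x) ((A t).covDeriv i ((A t).divCurvature j) x
      - (A t).covDeriv j ((A t).divCurvature i) x) := fun i j => hs_comm _ _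
  simp only [hc, hs_sub_right, Finset.sum_add_distrib, Finset.sum_sub_distrib, hswap]
  ring

/-- The energy density of a flow is smooth on space-time. -/
theorem IsYangMillsFlow.contDiffOn_curvatureNormSq (hA : IsYangMillsFlow T A)
    (hJ : UniqueDiffOn ℝ (timeInterval T)) :
    ContDiffOn ℝ ∞ (fun q : ℝ × EuclideanSpace ℝ (Fin n) => (A q.1).curvatureNormSq q.2)
      (timeInterval T ×ˢ Set.univ) := by
  have hΓ := hA.smooth
  have hdΓ : ∀ (i j : Fin n) (β α : Fin k), ContDiffOn ℝ ∞
      (fun q : ℝ × EuclideanSpace ℝ (Fin n) =>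
        partialDeriv i (fun y => (A q.1).coeff y j) q.2 β α) (timeInterval T ×ˢ Set.univ) :=
    fun i j β α => contDiffOn_spatial_fderiv hJ (hΓ j β α) (EuclideanSpace.single i 1)
  have hF : ∀ (i j : Fin n) (β α : Fin k), ContDiffOn ℝ ∞
      (fun q : ℝ × EuclideanSpace ℝ (Fin n) => (A q.1).curvature i j q.2 β α)
      (timeInterval T ×ˢ Set.univ) := by
    intro i j β α
    simp only [MetricConnection.curvature, Matrix.add_apply, Matrix.sub_apply, Matrix.mul_apply]
    exact (((hdΓ i j β α).sub (hdΓ j i β α)).add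
      (ContDiffOn.sum fun γ _ => (hΓ i β γ).mul (hΓ j γ α))).sub
      (ContDiffOn.sum fun γ _ => (hΓ j β γ).mul (hΓ i γ α))
  unfold MetricConnection.curvatureNormSq
  exact ContDiffOn.sum fun i _ => ContDiffOn.sum fun j _ => ContDiffOn.sum fun β _ =>
    ContDiffOn.sum fun α _ => (hF i j β α).norm_sq ℝ

end YangMills

/-! ### Cutoffs, the time-dependent Gaussian weight, and the tail estimate. -/

namespace YangMills

open MeasureTheory Topology Filter

section Cutoff

/-- At such points the function attains its global minimum 0 or maximum 1. -/
theorem deriv_smoothTransition_eq_zero {u : ℝ} (hu : u ≤ 0 ∨ 1 ≤ u) :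
    deriv Real.smoothTransition u = 0 := by
  rcases hu with hu | hu
  · refine IsLocalMin.deriv_eq_zero (Eventually.of_forall fun v => ?_)
    rw [Real.smoothTransition.zero_of_nonpos hu]
    exact Real.smoothTransition.nonneg v
  · refine IsLocalMax.deriv_eq_zero (Eventually.of_forall fun v => ?_)
    rw [Real.smoothTransition.one_of_one_le hu]
    exact Real.smoothTransition.le_one v

theorem exists_abs_deriv_smoothTransition_le :
    ∃ C, 0 ≤ C ∧ ∀ u, |deriv Real.smoothTransition u| ≤ C := by
  have hc : Continuous (deriv Real.smoothTransition) :=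
    (Real.smoothTransition.contDiff (n := 1)).continuous_deriv (by simp)
  obtain ⟨C, hC⟩ := (isCompact_Icc (a := (0 : ℝ)) (b := 1)).exists_bound_of_continuousOn
    hc.continuousOn
  have hC0 : 0 ≤ C := (norm_nonneg _).trans (hC 0 (by simp))
  refine ⟨C, hC0, fun u => ?_⟩
  by_cases hu : u ∈ Set.Icc (0 : ℝ) 1
  · exact hC u hu
  · have : u ≤ 0 ∨ 1 ≤ u := by
      by_contra! h
      exact hu ⟨h.1.le, h.2.le⟩
    rw [deriv_smoothTransition_eq_zero this, abs_zero]
    exact hC0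

variable {n : ℕ}

/-- A cutoff function that is `1` on the ball of radius `R` about `x₀` and `0` outside the ball of
radius `2 R`. -/
noncomputable def cutoff (R : ℝ) (x₀ x : EuclideanSpace ℝ (Fin n)) : ℝ :=
  Real.smoothTransition (2 - ‖x - x₀‖ ^ 2 / R ^ 2)

/-- Using the squared norm avoids the singularity of the norm at x₀. -/
theorem contDiff_cutoff (R : ℝ) (x₀ : EuclideanSpace ℝ (Fin n)) : ContDiff ℝ ∞ (cutoff R x₀) := by
  have h : ContDiff ℝ ∞ fun x : EuclideanSpace ℝ (Fin n) => ‖x - x₀‖ ^ 2 :=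
    (contDiff_id.sub contDiff_const).norm_sq ℝ
  exact Real.smoothTransition.contDiff.comp (contDiff_const.sub (h.div_const _))

theorem cutoff_nonneg (R : ℝ) (x₀ x : EuclideanSpace ℝ (Fin n)) : 0 ≤ cutoff R x₀ x :=
  Real.smoothTransition.nonneg _

theorem cutoff_le_one (R : ℝ) (x₀ x : EuclideanSpace ℝ (Fin n)) : cutoff R x₀ x ≤ 1 :=
  Real.smoothTransition.le_one _

theorem cutoff_eq_one {R : ℝ} {x₀ x : EuclideanSpace ℝ (Fin n)} (hR : 0 < R)
    (hx : ‖x - x₀‖ ≤ R) : cutoff R x₀ x = 1 := by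
  refine Real.smoothTransition.one_of_one_le ?_
  have : ‖x - x₀‖ ^ 2 / R ^ 2 ≤ 1 := by
    rw [div_le_one (by positivity)]
    exact pow_le_pow_left₀ (norm_nonneg _) hx 2
  linarith

theorem cutoff_eq_zero {R : ℝ} {x₀ x : EuclideanSpace ℝ (Fin n)} (hR : 0 < R)
    (hx : x ∉ Metric.closedBall x₀ (2 * R)) : cutoff R x₀ x = 0 := by
  refine Real.smoothTransition.zero_of_nonpos ?_
  rw [Metric.mem_closedBall, dist_eq_norm, not_le] at hx
  have : 2 ≤ ‖x - x₀‖ ^ 2 / R ^ 2 := by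
    rw [le_div_iff₀ (by positivity)]
    nlinarith
  linarith

theorem hasCompactSupport_cutoff {R : ℝ} (x₀ : EuclideanSpace ℝ (Fin n)) (hR : 0 < R) :
    HasCompactSupport (cutoff R x₀) :=
  HasCompactSupport.intro (isCompact_closedBall x₀ (2 * R)) fun _ hx => cutoff_eq_zero hR hx

theorem fderiv_cutoff (R : ℝ) (x₀ x : EuclideanSpace ℝ (Fin n)) (i : Fin n) :
    fderiv ℝ (cutoff R x₀) x (EuclideanSpace.single i 1)
      = deriv Real.smoothTransition (2 - ‖x - x₀‖ ^ 2 / R ^ 2) * (-(2 * (x i - x₀ i) / R ^ 2)) := by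
  have h1 : HasDerivAt Real.smoothTransition (deriv Real.smoothTransition
      (2 - ‖x + (0 : ℝ) • EuclideanSpace.single i (1 : ℝ) - x₀‖ ^ 2 / R ^ 2))
      (2 - ‖x + (0 : ℝ) • EuclideanSpace.single i (1 : ℝ) - x₀‖ ^ 2 / R ^ 2) :=
    ((Real.smoothTransition.contDiff (n := 1)).differentiable (by simp) _).hasDerivAt
  have h2 := h1.comp (0 : ℝ) (((hasDerivAt_norm_sub_sq x₀ x i).div_const (R ^ 2)).const_sub 2)
  simp only [zero_smul, add_zero] at h2
  exact (hasDerivAt_coordinateLine (contDiff_cutoff R x₀) i x).unique h2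

theorem sum_sub_sq (x₀ x : EuclideanSpace ℝ (Fin n)) :
    ∑ i, (x i - x₀ i) ^ 2 = ‖x - x₀‖ ^ 2 := by
  rw [EuclideanSpace.norm_sq_eq]
  simp

/-- The derivative terms of the cutoff are bounded, and vanish outside an annulus. -/
theorem exists_cutoff_error_le (x₀ : EuclideanSpace ℝ (Fin n)) {τ₀ : ℝ} (hτ₀ : 0 < τ₀) :
    ∃ K, 0 ≤ K ∧ ∀ R τ, 1 ≤ R → τ₀ ≤ τ → ∀ x,
      4 * ∑ i, fderiv ℝ (cutoff R x₀) x (EuclideanSpace.single i 1) ^ 2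
        + 2 * |cutoff R x₀ x| * |∑ i, fderiv ℝ (cutoff R x₀) x (EuclideanSpace.single i 1)
          * ((x i - x₀ i) / (2 * τ))|
        ≤ (Metric.ball x₀ (2 * R) \ Metric.ball x₀ R).indicator (fun _ => K) x := by
  obtain ⟨C, hC0, hC⟩ := exists_abs_deriv_smoothTransition_le
  -- With |x − x₀|² < 2R², the gradient satisfies |∇ψ|² ≤ 8C²/R² ≤ 8C² as R ≥ 1, whence 32C²; the
  -- radial term is at most 2 · C · 2/τ₀.
  refine ⟨32 * C ^ 2 + 4 * C / τ₀, by positivity, fun R τ hR hτ x => ?_⟩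
  have hR0 : 0 < R := by linarith
  have hτ0 : 0 < τ := by linarith
  set d := deriv Real.smoothTransition (2 - ‖x - x₀‖ ^ 2 / R ^ 2) with hd
  have h1 : ∑ i, fderiv ℝ (cutoff R x₀) x (EuclideanSpace.single i 1) ^ 2
      = d ^ 2 * (4 / R ^ 4) * ‖x - x₀‖ ^ 2 := by
    rw [← sum_sub_sq, Finset.mul_sum]
    refine Finset.sum_congr rfl fun i _ => ?_
    rw [fderiv_cutoff, ← hd]
    field_simp
    ring
  have h2 : ∑ i, fderiv ℝ (cutoff R x₀) x (EuclideanSpace.single i 1) * ((x i - x₀ i) / (2 * τ))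
      = -(d * (‖x - x₀‖ ^ 2 / (R ^ 2 * τ))) := by
    rw [← sum_sub_sq, Finset.sum_div, Finset.mul_sum, ← Finset.sum_neg_distrib]
    refine Finset.sum_congr rfl fun i _ => ?_
    rw [fderiv_cutoff, ← hd]
    field_simp
  rw [h1, h2, abs_neg, abs_mul]
  have hK : 0 ≤ 32 * C ^ 2 + 4 * C / τ₀ := by positivity
  by_cases hx : 2 - ‖x - x₀‖ ^ 2 / R ^ 2 ≤ 0 ∨ 1 ≤ 2 - ‖x - x₀‖ ^ 2 / R ^ 2
  · have hd0 : d = 0 := deriv_smoothTransition_eq_zero hx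
    rw [hd0]
    simpa using Set.indicator_nonneg (fun _ _ => hK) x
  push Not at hx
  obtain ⟨hx1, hx2⟩ := hx
  have hr2 : ‖x - x₀‖ ^ 2 < 2 * R ^ 2 := by
    rw [← div_lt_iff₀ (by positivity)]
    linarith
  have hr1 : R ^ 2 < ‖x - x₀‖ ^ 2 := by
    rw [← one_lt_div (by positivity)]
    linarith
  have hmem : x ∈ Metric.ball x₀ (2 * R) \ Metric.ball x₀ R := by
    rw [Set.mem_sdiff, Metric.mem_ball, Metric.mem_ball, dist_eq_norm, not_lt]
    exact ⟨lt_of_pow_lt_pow_left₀ 2 (by positivity) (by nlinarith),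
      (lt_of_pow_lt_pow_left₀ 2 (norm_nonneg _) hr1).le⟩
  rw [Set.indicator_of_mem hmem]
  have hdC : |d| ≤ C := hC _
  have hd2 : d ^ 2 ≤ C ^ 2 := by
    rw [← sq_abs]
    exact pow_le_pow_left₀ (abs_nonneg _) hdC 2
  have e1 : d ^ 2 * (4 / R ^ 4) * ‖x - x₀‖ ^ 2 ≤ 8 * C ^ 2 := by
    have : 4 / R ^ 4 * ‖x - x₀‖ ^ 2 ≤ 8 := by
      rw [div_mul_eq_mul_div, div_le_iff₀ (by positivity)]
      nlinarith [one_le_pow₀ hR (n := 2)]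
    calc d ^ 2 * (4 / R ^ 4) * ‖x - x₀‖ ^ 2 = d ^ 2 * (4 / R ^ 4 * ‖x - x₀‖ ^ 2) := by ring
      _ ≤ C ^ 2 * 8 := mul_le_mul hd2 this (by positivity) (by positivity)
      _ = _ := by ring
  have e2 : |‖x - x₀‖ ^ 2 / (R ^ 2 * τ)| ≤ 2 / τ₀ := by
    rw [abs_of_nonneg (by positivity), div_le_div_iff₀ (by positivity) hτ₀]
    exact (mul_le_mul hr2.le hτ hτ₀.le (by positivity)).trans_eq (by ring)
  have e3 : |cutoff R x₀ x| ≤ 1 := by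
    rw [abs_of_nonneg (cutoff_nonneg R x₀ x)]
    exact cutoff_le_one R x₀ x
  have e4 : 2 * |cutoff R x₀ x| * (|d| * |‖x - x₀‖ ^ 2 / (R ^ 2 * τ)|)
      ≤ 2 * 1 * (C * (2 / τ₀)) := by
    gcongr
  have e5 : 2 * 1 * (C * (2 / τ₀)) = 4 * C / τ₀ := by ring
  linarith

end Cutoff

/-- A polynomial times a Gaussian tends to zero. -/
theorem tendsto_exp_neg_sq_mul_eval (p : Polynomial ℝ) (d : ℝ) {c : ℝ} (hc : 0 < c) :
    Tendsto (fun N : ℕ => Real.exp (-(N : ℝ) ^ 2 / c) * |p.eval (2 * N + d)|) atTop (𝓝 0) := by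
  have h1 : Tendsto (fun x : ℝ => |(p.comp (2 * Polynomial.X + Polynomial.C d)).eval x / Real.exp x|)
      atTop (𝓝 0) := by
    simpa only [abs_zero] using (Polynomial.tendsto_div_exp_atTop
      (p.comp (2 * Polynomial.X + Polynomial.C d))).abs
  refine squeeze_zero' (Eventually.of_forall fun N => by positivity) ?_
    (h1.comp tendsto_natCast_atTop_atTop)
  -- Once N ≥ c, N²/c ≥ N, so the Gaussian lies below exp(−N).
  filter_upwards [tendsto_natCast_atTop_atTop.eventually (eventually_ge_atTop c)] with N hN
  simp only [Function.comp_apply, Polynomial.eval_comp, Polynomial.eval_add, Polynomial.eval_mul,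
    Polynomial.eval_X, Polynomial.eval_C, Polynomial.eval_ofNat, abs_div, Real.abs_exp]
  rw [div_eq_inv_mul _ (Real.exp (N : ℝ)), ← Real.exp_neg]
  refine mul_le_mul_of_nonneg_right (Real.exp_le_exp.2 ?_) (abs_nonneg _)
  rw [neg_div, neg_le_neg_iff, le_div_iff₀ hc]
  nlinarith

variable {𝕜 : Type*} [RCLike 𝕜] {n k : ℕ}

/-- The normalisation `τ² (4πτ)^(-n/2)`. -/
noncomputable def weightConst (n : ℕ) (τ : ℝ) : ℝ :=
  τ ^ 2 * (4 * Real.pi * τ) ^ (-(n : ℝ) / 2)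

theorem weightConst_nonneg (n : ℕ) {τ : ℝ} (hτ : 0 < τ) : 0 ≤ weightConst n τ := by
  have := Real.pi_pos
  unfold weightConst
  positivity

/-- The two factors are bounded at opposite ends of [τ₀, τ₁], since the power −n/2 is
non-increasing. This makes the tail estimate uniform in time. -/
theorem weightConst_le (n : ℕ) {τ₀ τ τ₁ : ℝ} (hτ₀ : 0 < τ₀) (h₀ : τ₀ ≤ τ) (h₁ : τ ≤ τ₁) :
    weightConst n τ ≤ τ₁ ^ 2 * (4 * Real.pi * τ₀) ^ (-(n : ℝ) / 2) := by
  have hπ := Real.pi_pos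
  have hτ : 0 < τ := hτ₀.trans_le h₀
  refine mul_le_mul (pow_le_pow_left₀ hτ.le h₁ 2) ?_ (by positivity) (by positivity)
  refine Real.rpow_le_rpow_of_nonpos (by positivity) (by gcongr) ?_
  rw [neg_div]
  exact neg_nonpos.2 (by positivity)

theorem hasDerivAt_weightConst (n : ℕ) {τ : ℝ} (hτ : 0 < τ) :
    HasDerivAt (weightConst n) (-((n / 2 - 2) / τ) * weightConst n τ) τ := by
  have hπ := Real.pi_pos
  have hpos : 0 < 4 * Real.pi * τ := by positivity
  have h1 : HasDerivAt (fun τ : ℝ => 4 * Real.pi * τ) (4 * Real.pi) τ := by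
    simpa using (hasDerivAt_id τ).const_mul (4 * Real.pi)
  have h := (hasDerivAt_pow 2 τ).mul (h1.rpow_const (p := -(n : ℝ) / 2) (Or.inl hpos.ne'))
  refine h.congr_deriv ?_
  unfold weightConst
  rw [Real.rpow_sub_one hpos.ne']
  simp only [Nat.cast_ofNat]
  field_simp
  ring

/-- With scale a − t, the normalisation contributes (n/2 − 2)/τ and the exponent −|x − x₀|²/(4τ²) =
−|X|²: the coefficient of |F|² in `divergence_identity`. -/
theorem hasDerivAt_weight (x₀ x : EuclideanSpace ℝ (Fin n)) {a t : ℝ} (ht : 0 < a - t) :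
    HasDerivAt (fun s => gaussianWeight (weightConst n (a - s)) (a - s) x₀ x)
      (((n / 2 - 2) / (a - t) - ∑ i, ((x i - x₀ i) / (2 * (a - t))) ^ 2)
        * gaussianWeight (weightConst n (a - t)) (a - t) x₀ x) t := by
  have h1 : HasDerivAt (fun s => a - s) (-1) t := by
    simpa using (hasDerivAt_id t).const_sub a
  have h2 := (hasDerivAt_weightConst n ht).comp t h1
  have h3 := (((h1.const_mul 4).inv (by positivity)).const_mul (-‖x - x₀‖ ^ 2)).exp
  have h := h2.mul h3
  simp only [Function.comp_def, Pi.inv_apply, ← div_eq_mul_inv] at h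
  refine h.congr_deriv ?_
  have h4 : ∑ i, ((x i - x₀ i) / (2 * (a - t))) ^ 2 = ‖x - x₀‖ ^ 2 / (2 * (a - t)) ^ 2 := by
    rw [← sum_sub_sq, Finset.sum_div]
    exact Finset.sum_congr rfl fun i _ => div_pow _ _ _
  rw [h4]
  unfold gaussianWeight
  have hne : a - t ≠ 0 := ht.ne'
  field_simp
  ring

theorem contDiffOn_weight (x₀ : EuclideanSpace ℝ (Fin n)) (a : ℝ) :
    ContDiffOn ℝ ∞ (fun q : ℝ × EuclideanSpace ℝ (Fin n) =>
      gaussianWeight (weightConst n (a - q.1)) (a - q.1) x₀ q.2) (Set.Iio a ×ˢ Set.univ) := by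
  have hπ := Real.pi_pos
  have h1 : ContDiff ℝ ∞ fun q : ℝ × EuclideanSpace ℝ (Fin n) => a - q.1 :=
    contDiff_const.sub contDiff_fst
  have h2 : ContDiff ℝ ∞ fun q : ℝ × EuclideanSpace ℝ (Fin n) => ‖q.2 - x₀‖ ^ 2 :=
    (contDiff_snd.sub contDiff_const).norm_sq ℝ
  have hpos : ∀ q ∈ Set.Iio a ×ˢ (Set.univ : Set (EuclideanSpace ℝ (Fin n))), 0 < a - q.1 :=
    fun q hq => sub_pos.2 hq.1
  unfold gaussianWeight weightConst
  refine ((h1.pow 2).contDiffOn.mul (ContDiffOn.rpow_const_of_ne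
    (contDiff_const.mul h1).contDiffOn fun q hq => ?_)).mul
    (ContDiffOn.exp (h2.neg.contDiffOn.div (contDiff_const.mul h1).contDiffOn fun q hq => ?_))
  · have := hpos q hq
    positivity
  · have := hpos q hq
    positivity

namespace MetricConnection

variable (A : MetricConnection 𝕜 n k)

theorem shrinkerFunctional_eq_lintegral (x₀ : EuclideanSpace ℝ (Fin n)) {t₀ : ℝ} (ht₀ : 0 < t₀) :
    A.shrinkerFunctional x₀ t₀ = ∫⁻ x, ENNReal.ofReal
      (gaussianWeight (weightConst n t₀) t₀ x₀ x * A.curvatureNormSq x) := by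
  have hc : Continuous fun x => A.curvatureNormSq x * Real.exp (-‖x - x₀‖ ^ 2 / (4 * t₀)) := by
    have := A.contDiff_curvatureNormSq.continuous
    fun_prop
  unfold shrinkerFunctional
  rw [← lintegral_const_mul _ hc.measurable.ennreal_ofReal]
  refine lintegral_congr fun x => ?_
  have hw := weightConst_nonneg n ht₀
  unfold weightConst at hw
  rw [← ENNReal.ofReal_mul hw]
  unfold gaussianWeight weightConst
  ring_nf

/-- Moves the centre of the growth bound from y to x₀ by enlarging the ball; the absolute value
makes the bound nonnegative at every radius. -/
theorem setIntegral_curvatureNormSq_le {y : EuclideanSpace ℝ (Fin n)} {p : Polynomial ℝ}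
    (h : A.HasEnergyGrowth y p) (x₀ : EuclideanSpace ℝ (Fin n)) {r : ℝ} (hr : 0 < r) :
    ∫ x in Metric.ball x₀ r, A.curvatureNormSq x ≤ |p.eval (r + dist x₀ y)| := by
  have hc := A.contDiff_curvatureNormSq.continuous
  rw [integral_eq_lintegral_of_nonneg_ae (Eventually.of_forall A.curvatureNormSq_nonneg)
    hc.aestronglyMeasurable]
  refine ENNReal.toReal_le_of_le_ofReal (abs_nonneg _) ?_
  calc _ ≤ ∫⁻ x in Metric.ball y (r + dist x₀ y), ENNReal.ofReal (A.curvatureNormSq x) :=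
        lintegral_mono_set (Metric.ball_subset_ball' le_rfl)
    _ ≤ ENNReal.ofReal (p.eval (r + dist x₀ y)) := h _ (by positivity)
    _ ≤ _ := ENNReal.ofReal_le_ofReal (le_abs_self _)

/-- The error caused by the cutoff is bounded by the tail of the Gaussian. -/
theorem integral_cutoff_error_le {y x₀ : EuclideanSpace ℝ (Fin n)} {p : Polynomial ℝ}
    (h : A.HasEnergyGrowth y p) {c c₁ τ τ₁ K R : ℝ} (hc : 0 ≤ c) (hc₁ : c ≤ c₁) (hτ : 0 < τ)
    (hτ₁ : τ ≤ τ₁) (hK : 0 ≤ K) (hR : 0 < R)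
    {err : EuclideanSpace ℝ (Fin n) → ℝ}
    (herr : ∀ x, err x ≤ (Metric.ball x₀ (2 * R) \ Metric.ball x₀ R).indicator (fun _ => K) x) :
    ∫ x, gaussianWeight c τ x₀ x * err x * A.curvatureNormSq x
      ≤ c₁ * K * (Real.exp (-R ^ 2 / (4 * τ₁)) * |p.eval (2 * R + dist x₀ y)|) := by
  have hint : IntegrableOn A.curvatureNormSq (Metric.ball x₀ (2 * R)) :=
    (A.contDiff_curvatureNormSq.continuous.continuousOn.integrableOn_compact
      (isCompact_closedBall x₀ (2 * R))).mono_set Metric.ball_subset_closedBall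
  have hC0 : 0 ≤ c₁ * K * Real.exp (-R ^ 2 / (4 * τ₁)) := by
    have := hc.trans hc₁
    positivity
  have hpt : ∀ x, gaussianWeight c τ x₀ x * err x * A.curvatureNormSq x
      ≤ c₁ * K * Real.exp (-R ^ 2 / (4 * τ₁))
        * (Metric.ball x₀ (2 * R)).indicator A.curvatureNormSq x := by
    intro x
    have hS := A.curvatureNormSq_nonneg x
    have hw : 0 ≤ gaussianWeight c τ x₀ x := mul_nonneg hc (Real.exp_pos _).le
    by_cases hx : x ∈ Metric.ball x₀ (2 * R) \ Metric.ball x₀ R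
    · have he := herr x
      rw [Set.indicator_of_mem hx] at he
      rw [Set.indicator_of_mem hx.1]
      refine mul_le_mul_of_nonneg_right ?_ hS
      have hxR : R ≤ ‖x - x₀‖ := by
        simpa [dist_eq_norm] using hx.2
      -- On the annulus the Gaussian factor is largest at the inner radius R and the largest scale
      -- τ₁.
      have hw2 : gaussianWeight c τ x₀ x ≤ c₁ * Real.exp (-R ^ 2 / (4 * τ₁)) := by
        refine mul_le_mul hc₁ (Real.exp_le_exp.2 ?_) (Real.exp_pos _).le (hc.trans hc₁)
        rw [neg_div, neg_div, neg_le_neg_iff]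
        exact div_le_div₀ (by positivity) (pow_le_pow_left₀ hR.le hxR 2) (by positivity)
          (by linarith)
      calc gaussianWeight c τ x₀ x * err x ≤ gaussianWeight c τ x₀ x * K :=
            mul_le_mul_of_nonneg_left he hw
        _ ≤ c₁ * Real.exp (-R ^ 2 / (4 * τ₁)) * K := mul_le_mul_of_nonneg_right hw2 hK
        _ = _ := by ring
    · have he := herr x
      rw [Set.indicator_of_notMem hx] at he
      have h1 : gaussianWeight c τ x₀ x * err x * A.curvatureNormSq x ≤ 0 :=
        mul_nonpos_of_nonpos_of_nonneg (mul_nonpos_of_nonneg_of_nonpos hw he) hS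
      exact h1.trans (mul_nonneg hC0 (Set.indicator_nonneg
        (fun x _ => A.curvatureNormSq_nonneg x) x))
  have hgi : Integrable fun x => c₁ * K * Real.exp (-R ^ 2 / (4 * τ₁))
      * (Metric.ball x₀ (2 * R)).indicator A.curvatureNormSq x :=
    (hint.integrable_indicator Metric.isOpen_ball.measurableSet).const_mul _
  have hle : ∫ x, gaussianWeight c τ x₀ x * err x * A.curvatureNormSq x
      ≤ ∫ x, c₁ * K * Real.exp (-R ^ 2 / (4 * τ₁))
        * (Metric.ball x₀ (2 * R)).indicator A.curvatureNormSq x := by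
    -- As `err` is arbitrary, the left integrand may fail to be integrable; its integral is then 0
    -- by convention, and the bound is nonnegative.
    by_cases hi : Integrable fun x => gaussianWeight c τ x₀ x * err x * A.curvatureNormSq x
    · exact integral_mono hi hgi hpt
    · rw [integral_undef hi]
      exact integral_nonneg fun x => mul_nonneg hC0 (Set.indicator_nonneg
        (fun x _ => A.curvatureNormSq_nonneg x) x)
  refine hle.trans ?_
  rw [integral_const_mul, integral_indicator Metric.isOpen_ball.measurableSet, ← mul_assoc]
  exact mul_le_mul_of_nonneg_left (A.setIntegral_curvatureNormSq_le h x₀ (by positivity)) hC0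

end MetricConnection

end YangMills

/-! ### The monotonicity formula along the flow. -/

namespace YangMills

open MeasureTheory Topology Filter

variable {𝕜 : Type*} [RCLike 𝕜] {n k : ℕ} {T : EReal} {A : ℝ → MetricConnection 𝕜 n k}

/-- The localised functional changes along the flow by at most the error of the cutoff. -/
theorem IsYangMillsFlow.localized_functional_le (hA : IsYangMillsFlow T A) {t₁ t₂ a : ℝ}
    (h₁ : t₁ ∈ timeInterval T) (h₂ : t₂ ∈ timeInterval T) (h : t₁ < t₂) (ha : t₂ < a)
    (x₀ : EuclideanSpace ℝ (Fin n)) {ψ : EuclideanSpace ℝ (Fin n) → ℝ} (hψ : ContDiff ℝ ∞ ψ)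
    (hψc : HasCompactSupport ψ) {δ : ℝ}
    (hδ : ∀ t ∈ Set.Ioo t₁ t₂, ∫ x, gaussianWeight (weightConst n (a - t)) (a - t) x₀ x
      * (4 * ∑ i, fderiv ℝ ψ x (EuclideanSpace.single i 1) ^ 2
        + 2 * |ψ x| * |∑ i, fderiv ℝ ψ x (EuclideanSpace.single i 1)
          * ((x i - x₀ i) / (2 * (a - t)))|) * (A t).curvatureNormSq x ≤ δ) :
    ∫ x, ψ x ^ 2 * gaussianWeight (weightConst n (a - t₂)) (a - t₂) x₀ x
        * (A t₂).curvatureNormSq x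
      ≤ (∫ x, ψ x ^ 2 * gaussianWeight (weightConst n (a - t₁)) (a - t₁) x₀ x
        * (A t₁).curvatureNormSq x) + δ * (t₂ - t₁) := by
  have hsub : Set.Icc t₁ t₂ ⊆ timeInterval T := (ordConnected_timeInterval T).out h₁ h₂
  have hG : ContDiffOn ℝ ∞ (fun q : ℝ × EuclideanSpace ℝ (Fin n) =>
      ψ q.2 ^ 2 * gaussianWeight (weightConst n (a - q.1)) (a - q.1) x₀ q.2
        * (A q.1).curvatureNormSq q.2) (Set.Icc t₁ t₂ ×ˢ Set.univ) :=
    ((((hψ.comp contDiff_snd).pow 2).contDiffOn.mul ((contDiffOn_weight x₀ a).mono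
      (Set.prod_mono (fun t ht => ht.2.trans_lt ha) le_rfl))).mul
      ((hA.contDiffOn_curvatureNormSq (uniqueDiffOn_timeInterval h₁ h₂ h)).mono
        (Set.prod_mono hsub le_rfl)))
  have h0 : ∀ s, ∀ x ∉ tsupport ψ,
      ψ x ^ 2 * gaussianWeight (weightConst n (a - s)) (a - s) x₀ x * (A s).curvatureNormSq x
        = 0 := by
    intro s x hx
    simp [image_eq_zero_of_notMem_tsupport hx]
  -- Continuity on the closed interval allows differentiation at interior times only; t₁ may be 0.
  have hcont : ContinuousOn (fun t => ∫ x, ψ x ^ 2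
      * gaussianWeight (weightConst n (a - t)) (a - t) x₀ x * (A t).curvatureNormSq x)
      (Set.Icc t₁ t₂) :=
    continuousOn_integral_of_compact_support hψc hG.continuousOn fun s x _ hx => h0 s x hx
  have hderiv : ∀ t ∈ Set.Ioo t₁ t₂, HasDerivAt (fun t => ∫ x, ψ x ^ 2
      * gaussianWeight (weightConst n (a - t)) (a - t) x₀ x * (A t).curvatureNormSq x)
      (∫ x, (4 * (ψ x ^ 2 * gaussianWeight (weightConst n (a - t)) (a - t) x₀ x)
        * ∑ i, ∑ j, hs ((A t).curvature i j x) ((A t).covDeriv i ((A t).divCurvature j) x)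
      + ((n / 2 - 2) / (a - t) - ∑ i, ((x i - x₀ i) / (2 * (a - t))) ^ 2)
        * (ψ x ^ 2 * gaussianWeight (weightConst n (a - t)) (a - t) x₀ x)
          * (A t).curvatureNormSq x)) t := by
    intro t ht
    have hd := hasDerivAt_integral_of_contDiffOn (μ := volume) hψc isOpen_Ioo
      (hG.mono (Set.prod_mono Set.Ioo_subset_Icc_self le_rfl)) (fun s x hx => h0 s x hx) ht
    refine hd.congr_deriv (integral_congr_ae (Eventually.of_forall fun x => ?_))
    have hnhds : timeInterval T ∈ 𝓝 t := mem_of_superset (Icc_mem_nhds ht.1 ht.2) hsub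
    have hx := ((hasDerivAt_weight x₀ x (sub_pos.2 (ht.2.trans ha))).const_mul (ψ x ^ 2)).mul
      (hA.hasDerivAt_curvatureNormSq hnhds x)
    refine (HasDerivAt.deriv hx).trans ?_
    ring
  have key := (convex_Icc t₁ t₂).image_sub_le_mul_sub_of_deriv_le hcont
    (fun t ht => by
      rw [interior_Icc] at ht
      exact (hderiv t ht).differentiableAt.differentiableWithinAt) (C := δ)
    (fun t ht => by
      rw [interior_Icc] at ht
      rw [(hderiv t ht).deriv]
      exact ((A t).integral_energy_density_le
        (weightConst_nonneg n (sub_pos.2 (ht.2.trans ha))) hψ hψc).trans (hδ t ht))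
    t₁ (Set.left_mem_Icc.2 h.le) t₂ (Set.right_mem_Icc.2 h.le) h.le
  linarith

/-- The monotonicity formula: the functional based at a fixed point of space-time is non-increasing
along the flow. -/
theorem IsYangMillsFlow.shrinkerFunctional_le (hA : IsYangMillsFlow T A)
    (hgrowth : HasPolynomialEnergyGrowth T A) {t₁ t₂ : ℝ} (h₁ : t₁ ∈ timeInterval T)
    (h₂ : t₂ ∈ timeInterval T) (h : t₁ < t₂) (x₀ : EuclideanSpace ℝ (Fin n)) {t₀ : ℝ}
    (ht₀ : 0 < t₀) :
    (A t₂).shrinkerFunctional x₀ t₀ ≤ (A t₁).shrinkerFunctional x₀ (t₀ + t₂ - t₁) := by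
  obtain ⟨y, p, hp⟩ := hgrowth t₂ h₂
  obtain ⟨K, hK0, hK⟩ := exists_cutoff_error_le x₀ ht₀
  -- The scale a − t equals t₀ at time t₂ and t₀ + t₂ − t₁ at time t₁; it never falls below t₀ in
  -- between, so K serves all these times.
  set a := t₀ + t₂ with ha
  have hat₂ : a - t₂ = t₀ := by rw [ha]; ring
  have hpos₁ : 0 < a - t₁ := by linarith
  set c₁ : ℝ := (a - t₁) ^ 2 * (4 * Real.pi * t₀) ^ (-(n : ℝ) / 2) with hc₁
  set δ : ℕ → ℝ := fun N => c₁ * K * (Real.exp (-(N : ℝ) ^ 2 / (4 * (a - t₁)))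
    * |p.eval (2 * N + dist x₀ y)|) with hδ
  have hδlim : Tendsto (fun N => ENNReal.ofReal (δ N * (t₂ - t₁))) atTop (𝓝 0) := by
    have := ((tendsto_exp_neg_sq_mul_eval p (dist x₀ y)
      (by positivity : 0 < 4 * (a - t₁))).const_mul (c₁ * K)).mul_const (t₂ - t₁)
    simpa using ENNReal.tendsto_ofReal this
  set f : ℝ → EuclideanSpace ℝ (Fin n) → ℝ := fun t x =>
    gaussianWeight (weightConst n (a - t)) (a - t) x₀ x * (A t).curvatureNormSq x with hf
  have hf0 : ∀ t, t ≤ t₂ → ∀ x, 0 ≤ f t x := fun t ht x =>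
    mul_nonneg (mul_nonneg (weightConst_nonneg n (by linarith)) (Real.exp_pos _).le)
      ((A t).curvatureNormSq_nonneg x)
  have hfc : ∀ t, Continuous (f t) := fun t =>
    (contDiff_gaussianWeight _ _ x₀).continuous.mul (A t).contDiff_curvatureNormSq.continuous
  have hloc : ∀ (t : ℝ), t ≤ t₂ → ∀ N : ℕ, 1 ≤ N →
      ENNReal.ofReal (∫ x, cutoff N x₀ x ^ 2
        * gaussianWeight (weightConst n (a - t)) (a - t) x₀ x * (A t).curvatureNormSq x)
      = ∫⁻ x, ENNReal.ofReal (cutoff N x₀ x ^ 2 * f t x) := by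
    intro t ht N hN
    have hN0 : (0 : ℝ) < N := by exact_mod_cast hN
    simp only [mul_assoc]
    refine ofReal_integral_eq_lintegral_ofReal
      (((((contDiff_cutoff _ x₀).continuous.pow 2).mul
        (hfc t))).integrable_of_hasCompactSupport ?_)
      (Eventually.of_forall fun x => mul_nonneg (sq_nonneg _) (hf0 t ht x))
    refine HasCompactSupport.intro (hasCompactSupport_cutoff x₀ hN0) fun x hx => ?_
    simp [image_eq_zero_of_notMem_tsupport hx]
  -- On the left the cutoff is 1 on the ball, on the right it is at most 1; working in [0, ∞], no
  -- integrability over the whole space is needed.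
  have hstep : ∀ N : ℕ, 1 ≤ N → ∫⁻ x in Metric.ball x₀ N, ENNReal.ofReal (f t₂ x)
      ≤ (∫⁻ x, ENNReal.ofReal (f t₁ x)) + ENNReal.ofReal (δ N * (t₂ - t₁)) := by
    intro N hN
    have hN1 : (1 : ℝ) ≤ N := by exact_mod_cast hN
    have hN0 : (0 : ℝ) < N := by linarith
    have hmain := hA.localized_functional_le h₁ h₂ h (a := a) (by linarith) x₀
      (contDiff_cutoff (N : ℝ) x₀) (hasCompactSupport_cutoff x₀ hN0) (δ := δ N) (by
        intro t ht
        have hτ0 : t₀ ≤ a - t := by linarith [ht.2]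
        have hτ1 : a - t ≤ a - t₁ := by linarith [ht.1]
        exact (A t).integral_cutoff_error_le (hp t ⟨h₁.1.trans ht.1.le, ht.2.le⟩)
          (weightConst_nonneg n (by linarith)) (weightConst_le n ht₀ hτ0 hτ1) (by linarith) hτ1
          hK0 hN0 (hK N (a - t) hN1 hτ0))
    calc ∫⁻ x in Metric.ball x₀ N, ENNReal.ofReal (f t₂ x)
        = ∫⁻ x in Metric.ball x₀ N, ENNReal.ofReal (cutoff N x₀ x ^ 2 * f t₂ x) := by
          refine setLIntegral_congr_fun Metric.isOpen_ball.measurableSet fun x hx => ?_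
          rw [Metric.mem_ball, dist_eq_norm] at hx
          simp only [cutoff_eq_one hN0 hx.le, one_pow, one_mul]
      _ ≤ ∫⁻ x, ENNReal.ofReal (cutoff N x₀ x ^ 2 * f t₂ x) := setLIntegral_le_lintegral _ _
      _ = _ := (hloc t₂ le_rfl N hN).symm
      _ ≤ _ := ENNReal.ofReal_le_ofReal hmain
      _ ≤ _ := ENNReal.ofReal_add_le
      _ ≤ _ := by
          rw [hloc t₁ h.le N hN]
          gcongr with x
          exact mul_le_of_le_one_left (hf0 t₁ h.le x)
            (pow_le_one₀ (cutoff_nonneg _ _ _) (cutoff_le_one _ _ _))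
  rw [(A t₂).shrinkerFunctional_eq_lintegral x₀ ht₀,
    (A t₁).shrinkerFunctional_eq_lintegral x₀ hpos₁]
  have hunion : ∫⁻ x, ENNReal.ofReal (f t₂ x)
      = ⨆ N : ℕ, ∫⁻ x in Metric.ball x₀ N, ENNReal.ofReal (f t₂ x) := by
    rw [← setLIntegral_iUnion_of_directed, Metric.iUnion_ball_nat, setLIntegral_univ]
    exact (monotone_nat_of_le_succ fun N => Metric.ball_subset_ball
      (by push_cast; linarith)).directed_le
  have hgoal : ∫⁻ x, ENNReal.ofReal (f t₂ x) ≤ ∫⁻ x, ENNReal.ofReal (f t₁ x) := by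
    rw [hunion]
    refine iSup_le fun N => ?_
    have hlim : Tendsto (fun M => (∫⁻ x, ENNReal.ofReal (f t₁ x))
        + ENNReal.ofReal (δ M * (t₂ - t₁))) atTop (𝓝 (∫⁻ x, ENNReal.ofReal (f t₁ x))) := by
      simpa using hδlim.const_add (∫⁻ x, ENNReal.ofReal (f t₁ x))
    refine ge_of_tendsto hlim ?_
    -- The ball of radius N stays fixed while the cutoff radius M tends to infinity; the maximum
    -- with 1 provides M ≥ 1 for the cutoff estimate.
    filter_upwards [eventually_ge_atTop (max N 1)] with M hM
    refine (lintegral_mono_set (Metric.ball_subset_ball ?_)).trans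
      (hstep M ((le_max_right _ _).trans hM))
    exact_mod_cast (le_max_left _ _).trans hM
  simpa only [hf, hat₂] using hgoal

end YangMills

theorem mainTheorem6 {𝕜 : Type*} [RCLike 𝕜] (n k : ℕ) (T : EReal)
    (A : ℝ → YangMills.MetricConnection 𝕜 n k)
    (hflow : YangMills.IsYangMillsFlow T A)
    (hgrowth : YangMills.HasPolynomialEnergyGrowth T A) :
    AntitoneOn (fun t => (A t).entropy) (YangMills.timeInterval T) := by
  intro t₁ h₁ t₂ h₂ h
  rcases h.eq_or_lt with rfl | hlt
  · exact le_rfl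
  refine iSup_le fun x₀ => iSup_le fun t₀ => iSup_le fun ht₀ => ?_
  refine (hflow.shrinkerFunctional_le hgrowth h₁ h₂ hlt x₀ ht₀).trans ?_
  -- The supremum at time t₁ runs over all positive scales, so it includes the larger scale t₀ + t₂
  -- − t₁.
  exact le_iSup_of_le x₀ (le_iSup₂_of_le (t₀ + t₂ - t₁) (by linarith) le_rfl)
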